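/- **Setting.** Let $d \in \mathbb{N}$ and let $\ell : [0,\infty)^d \to \mathbb{R}$ be a stable tail dependence function (stdf): there is a random vector $(X_1,\dots,X_d)$ with continuous marginal distribution functions $F_1,\dots,F_d$ such that, for every $x \in [0,\infty)^d$, $$\ell(x) = \lim_{t \downarrow 0} t^{-1}\, \mathbb{P}\{F_1(X_1) > 1 - t x_1 \text{ or } \dots \text{ or } F_d(X_d) > 1 - t x_d\}.$$ Let $k = k_n \in (0,n]$ be real numbers ($n \ge 1$). For each $n$ let $\hat\ell_{n,k}$ be a random real-valued function on $[0,n/k]^d$, defined on some probability space that may depend on $n$; nothing else is assumed about how it is constructed. For $x \in [0,n/k]^d$ let $\nu_{n,k,x}$ be the law of $(T_1/k,\dots,T_d/k)$, where $T_1,\dots,T_d$ are independent and $T_j \sim \operatorname{Bin}(n, \tfrac{k}{n} x_j)$, and put $$\hat\ell^{\beta}_{n,k}(x) = \int_{[0,n/k]^d} \hat\ell_{n,k}(y)\, \mathrm{d}\nu_{n,k,x}(y), \qquad x \in [0,n/k]^d.$$ For a set $T$, $\ell^\infty(T)$ is the Banach space of bounded functions $T \to \mathbb{R}$ with the supremum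 norm. Weak convergence $\leadsto$ in $\ell^\infty(T)$ is in the sense of Hoffmann-Jørgensen: the limit is Borel measurable and outer expectations of bounded continuous functionals converge to the expectation under the limit. The symbols $\mathrm{O}_{\mathbb{P}}$ and $\mathrm{o}_{\mathbb{P}}$ refer to outer probability. **Theorem.** Assume that $\log(n) = \mathrm{o}(k)$ and $k = \mathrm{o}(n)$ as $n \to \infty$, and that 1. for every $j \in \{1,\dots,d\}$, the function $\ell$ has a continuous first-order partial derivative $\partial \ell/\partial x_j$ on $\{x \in [0,\infty)^d : x_j > 0\}$; 2. $\sup_{y \in [0,n/k]^d} |\hat\ell_{n,k}(y)| = \mathrm{O}_{\mathbb{P}}(n/k)$ as $n \to \infty$; 3. there exist $\delta > 0$ and a stochastic process $B$ on $[0,1+\delta]^d$ with continuous trajectories such that $\sqrt{k}\,(\hat\ell_{n,k} - \ell) \leadsto B$ in $\ell^\infty([0,1+\delta]^d)$ as $n \to \infty$ (in particular, for all large $n$ the trajectories of $\hat\ell_{n,k}$ are bounded on $[0,1+\delta]^d$). Then, as $n \to \infty$, $$\sup_{x \in [0,1]^d} \bigl| \sqrt{k}\,(\hat\ell^{\beta}_{n,k}(x)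 - \ell(x)) - \sqrt{k}\,(\hat\ell_{n,k}(x) - \ell(x)) \bigr| = \mathrm{o}_{\mathbb{P}}(1),$$ and both $\sqrt{k}\,(\hat\ell_{n,k} - \ell) \leadsto B$ and $\sqrt{k}\,(\hat\ell^{\beta}_{n,k} - \ell) \leadsto B$ in $\ell^\infty([0,1]^d)$, where $B$ is restricted to $[0,1]^d$. -/

import Mathlib

open MeasureTheory ProbabilityTheory Filter Topology Asymptotics
open scoped ENNReal NNReal BoundedContinuousFunction

noncomputable section

namespace BetaStdf

/-- The cube `[0, M]^d`. -/
def cube (d : ℕ) (M : ℝ) : Set (Fin d → ℝ) := Set.Icc 0 (fun _ => M)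

/-- `l` is (on `[0, ∞)^d`) the stable tail dependence function of some probability law `F` on `ℝ^d`
with continuous marginal distribution functions `F_1, …, F_d`:
`l x = lim_{t ↓ 0} t⁻¹ P (F_1 (X_1) > 1 - t x_1 or … or F_d (X_d) > 1 - t x_d)` with `X ∼ F`,
the limit existing for every `x ∈ [0, ∞)^d`. -/
def IsStdf (d : ℕ) (l : (Fin d → ℝ) → ℝ) : Prop :=
  ∃ F : Measure (Fin d → ℝ), IsProbabilityMeasure F ∧
    (∀ j, Continuous (fun s : ℝ => cdf (F.map (fun X => X j)) s)) ∧
    ∀ x : Fin d → ℝ, 0 ≤ x →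
      Tendsto
        (fun t : ℝ =>
          t⁻¹ * F.real {X | ∃ j, 1 - t * x j < cdf (F.map (fun X => X j)) (X j)})
        (𝓝[>] 0) (𝓝 (l x))

/-- For every `j`, the function `l` has a continuous first-order partial derivative with respect to
the `j`-th variable on `{x ∈ [0, ∞)^d | x_j > 0}`. (Only values of `l` on `[0, ∞)^d` matter.) -/
def HasContPartials (d : ℕ) (l : (Fin d → ℝ) → ℝ) : Prop :=
  ∀ j : Fin d, ∃ l' : (Fin d → ℝ) → ℝ,
    ContinuousOn l' {x | 0 ≤ x ∧ 0 < x j} ∧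
    ∀ x : Fin d → ℝ, 0 ≤ x → 0 < x j →
      HasDerivAt (fun s : ℝ => l (Function.update x j s)) (l' x) (x j)

/-- The beta smoother `ν_{n,k,x}`: the law of `(T_1 / k, …, T_d / k)` where `T_1, …, T_d` are
independent and `T_j ∼ Bin(n, (k / n) x_j)`. It is used for `x ∈ [0, n / k]^d` only; there
`(k / n) x_j ∈ [0, 1]`, so that the projection to `[0, 1]` does nothing. -/
def betaSmoother {d : ℕ} (n : ℕ) (k : ℝ) (x : Fin d → ℝ) : Measure (Fin d → ℝ) :=
  Measure.pi fun j =>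
    (binomial n (Set.projIcc (0 : ℝ) 1 zero_le_one (k / n * x j))).map (fun t : ℕ => (t : ℝ) / k)

/-- `x ↦ ∫_{[0, n/k]^d} g(y) dν_{n,k,x}(y)`. The measure has finite support, hence the integral is
a finite sum and exists for every `g`. -/
def betaSmooth {d : ℕ} (n : ℕ) (k : ℝ) (g : (Fin d → ℝ) → ℝ) (x : Fin d → ℝ) : ℝ :=
  ∫ y in cube d ((n : ℝ) / k), g y ∂(betaSmoother n k x)

/-- The supremum of `|f|` over `S`, possibly infinite. -/
def supNorm {d : ℕ} (S : Set (Fin d → ℝ)) (f : (Fin d → ℝ) → ℝ) : ℝ≥0∞ := ⨆ x ∈ S, ‖f x‖ₑ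

section Stochastic

variable {Ω : ℕ → Type*} [∀ n, MeasurableSpace (Ω n)]

/-- `Z_n = o_P(1)`, in outer probability: `Z_n` need not be measurable, and the value of a
`Measure` at an arbitrary set is its outer measure. -/
def IsLittleOP (P : ∀ n, Measure (Ω n)) (Z : ∀ n, Ω n → ℝ≥0∞) : Prop :=
  ∀ ε : ℝ≥0∞, 0 < ε → Tendsto (fun n => P n {ω | ε ≤ Z n ω}) atTop (𝓝 0)

/-- `Z_n = O_P(a_n)` as `n → ∞`, in outer probability. -/
def IsBigOP (P : ∀ n, Measure (Ω n)) (Z : ∀ n, Ω n → ℝ≥0∞) (a : ℕ → ℝ) : Prop :=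
  ∀ ε : ℝ≥0∞, 0 < ε → ∃ M : ℝ≥0, ∀ᶠ n in atTop, P n {ω | M * ENNReal.ofReal (a n) < Z n ω} ≤ ε

/-- Outer expectation `E^* f = inf {E U | U ≥ f, U measurable with finite expectation}` of a bounded,
not necessarily measurable function `f` on a probability space. -/
def outerExp {A : Type*} [MeasurableSpace A] (P : Measure A) (f : A → ℝ) : ℝ :=
  sInf {r : ℝ | ∃ U : A → ℝ, Measurable U ∧ Integrable U P ∧ (∀ ω, f ω ≤ U ω) ∧ r = ∫ ω, U ω ∂P}

/-- Weak convergence in the sense of Hoffmann-Jørgensen: the limit is Borel measurable and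
`E^* f(X_n) → E f(X)` for all bounded continuous `f`. -/
def WeakConv {E : Type*} [PseudoMetricSpace E] (P : ∀ n, Measure (Ω n)) (X : ∀ n, Ω n → E)
    {Ω' : Type*} [MeasurableSpace Ω'] (Q : Measure Ω') (Y : Ω' → E) : Prop :=
  Measurable[_, borel E] Y ∧
    ∀ f : E →ᵇ ℝ,
      Tendsto (fun n => outerExp (P n) (fun ω => f (X n ω))) atTop (𝓝 (∫ ω, f (Y ω) ∂Q))

/-- The Banach space `ℓ^∞(S)` of bounded real functions on `S`, with the supremum norm. -/
abbrev Linf {d : ℕ} (S : Set (Fin d → ℝ)) : Type := lp (fun _ : S => ℝ) ∞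

/-- `f` is bounded on `S`, that is, its restriction belongs to `ℓ^∞(S)`. -/
def BddOnSet {d : ℕ} (S : Set (Fin d → ℝ)) (f : (Fin d → ℝ) → ℝ) : Prop :=
  Memℓp (E := fun _ : S => ℝ) (fun x => f x) ∞

open Classical in
/-- The restriction of `f` to `S` as an element of `ℓ^∞(S)` (zero if `f` is unbounded on `S`). -/
def toLinf {d : ℕ} (S : Set (Fin d → ℝ)) (f : (Fin d → ℝ) → ℝ) : Linf S :=
  if h : BddOnSet S f then ⟨fun x : S => f x, h⟩ else 0

/-- `X_n ⇝ Y` in `ℓ^∞(S)`: for all large `n` the trajectories of `X_n` are bounded on `S`, so are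
those of `Y`, and the restrictions to `S` converge weakly in `ℓ^∞(S)`. -/
def WeakConvLinf {d : ℕ} (S : Set (Fin d → ℝ)) (P : ∀ n, Measure (Ω n))
    (X : ∀ n, Ω n → (Fin d → ℝ) → ℝ) {Ω' : Type*} [MeasurableSpace Ω'] (Q : Measure Ω')
    (Y : Ω' → (Fin d → ℝ) → ℝ) : Prop :=
  (∀ᶠ n in atTop, ∀ ω, BddOnSet S (X n ω)) ∧ (∀ ω, BddOnSet S (Y ω)) ∧
    WeakConv P (fun n ω => toLinf S (X n ω)) Q (fun ω => toLinf S (Y ω))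

end Stochastic

end BetaStdf

end

noncomputable section

namespace BetaStdf

/-! ### The probability integral transform and the Lipschitz property of an stdf -/

/-! Write `W = √k (l̂ - l)`. Since `ν_{n,k,x}` is a probability measure, the smoothing error at `x`
splits exactly (`smoothing_error_eq`) into the averaged increment `∫ (W y - W x) dν` and the
deterministic bias `√k ∫ (l y - l x) dν`. The smoother has mean `x` and coordinate variances at most
`x_j / k`, and it lives on a finite grid, so every function can be integrated against it, measurable
or not.

The increment (`abs_integral_increment_le`) is estimated on three regions. Within distance `η` of
`x` it is at most the modulus of continuity of `W`, small in probability because the weak limit has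
continuous paths. In the rest of `[0, 1+δ]^d`, `W` is bounded in probability and the mass is
`O(1/k)` by Chebyshev. Outside, `|W|` is at most of order `√k · n/k ≤ n`, while a Chernoff bound
gives mass `O(exp(-c k))`; as `log n = o(k)`, the product vanishes.

For the bias (`IsStdf.exists_bias_bound`) the Lipschitz property alone gives only `O(1)` after
multiplication by `√k`. A first-order expansion gains the missing factor: its linear term integrates
to zero, and where `x_j` is bounded away from zero the remainder is small by uniform continuity of
the partial derivative. Where `x_j` is small no differentiability is needed, because the mean
deviation `√(x_j / k)` is itself small compared with `1/√k`.

The weak limits then follow from continuity of restriction and a Slutsky lemma for outer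
expectations, proved by approximating test functions from above by Lipschitz ones. -/

lemma exists_cdf_eq {μ : Measure ℝ} (hc : Continuous (fun s => cdf μ s)) {u : ℝ} (h0 : 0 < u)
    (h1 : u < 1) : ∃ s, cdf μ s = u := by
  obtain ⟨a, ha⟩ := ((tendsto_cdf_atBot μ).eventually (gt_mem_nhds h0)).exists
  obtain ⟨b, hb⟩ := ((tendsto_cdf_atTop μ).eventually (lt_mem_nhds h1)).exists
  exact mem_range_of_exists_le_of_exists_ge hc ⟨a, ha.le⟩ ⟨b, hb.le⟩

/-- If `μ` has a continuous distribution function `G` and `X ∼ μ`, then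
`P (a < G X ≤ b) ≤ b - a` for `0 < a ≤ b`. -/
lemma measureReal_cdf_mem_Ioc_le {μ : Measure ℝ} [IsProbabilityMeasure μ]
    (hc : Continuous (fun s => cdf μ s)) {a b : ℝ} (ha : 0 < a) (hab : a ≤ b) :
    μ.real {s | a < cdf μ s ∧ cdf μ s ≤ b} ≤ b - a := by
  rcases le_or_gt 1 a with h1 | h1
  · have : {s | a < cdf μ s ∧ cdf μ s ≤ b} = ∅ := by
      ext s
      simp only [Set.mem_ofPred_eq, Set.mem_empty_iff_false, iff_false, not_and]
      intro h
      linarith [cdf_le_one μ s]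
    rw [this]
    simpa using hab
  obtain ⟨s, hs⟩ := exists_cdf_eq hc ha h1
  -- The slack `c > b - a` leaves room for a level strictly above `b`: a point with distribution
  -- function at most `b` then lies below the quantile of that level, even if the distribution
  -- function is flat at height `b`.
  refine le_of_forall_gt_imp_ge_of_dense fun c hc' => ?_
  have hIoi : μ.real (Set.Ioi s) = 1 - a := by
    rw [← Set.compl_Iic, probReal_compl_eq_one_sub measurableSet_Iic, ← cdf_eq_real, hs]
  have hgt : ∀ r, a < cdf μ r → s < r := by
    intro r hr
    by_contra h
    have := monotone_cdf μ (not_lt.1 h)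
    linarith
  set c' := c + a with hc'def
  have hbc : b < c' := by simp only [hc'def]; linarith
  rcases le_or_gt 1 c' with h2 | h2
  · have : μ.real {s | a < cdf μ s ∧ cdf μ s ≤ b} ≤ μ.real (Set.Ioi s) :=
      measureReal_mono (fun r hr => hgt r hr.1)
    linarith
  · obtain ⟨r, hr⟩ := exists_cdf_eq hc (by linarith : 0 < c') h2
    have hsr : s ≤ r := (hgt r (by linarith)).le
    have h3 : μ.real {s | a < cdf μ s ∧ cdf μ s ≤ b} ≤ μ.real (Set.Iic r \ Set.Iic s) := by
      refine measureReal_mono (fun q hq => ⟨?_, fun h => absurd (hgt q hq.1) (not_lt.2 h)⟩)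
      by_contra h
      have := monotone_cdf μ (not_le.1 h).le
      linarith [hq.2]
    rw [measureReal_sdiff (Set.Iic_subset_Iic.2 hsr) measurableSet_Iic, ← cdf_eq_real,
      ← cdf_eq_real, hs, hr] at h3
    linarith

/-- A stable tail dependence function is `1`-Lipschitz for the `ℓ¹`-distance. -/
lemma IsStdf.sub_le {d : ℕ} {l : (Fin d → ℝ) → ℝ} (hl : IsStdf d l) {x y : Fin d → ℝ}
    (hx : 0 ≤ x) (hy : 0 ≤ y) : l x - l y ≤ ∑ j, |x j - y j| := by
  obtain ⟨F, hF, hc, hlim⟩ := hl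
  have hm : ∀ j, IsProbabilityMeasure (F.map (fun X : Fin d → ℝ => X j)) := fun j =>
    Measure.isProbabilityMeasure_map (measurable_pi_apply j).aemeasurable
  refine le_of_tendsto ((hlim x hx).sub (hlim y hy)) ?_
  -- This makes the lower level `1 - t * x j` positive, as the strip bound requires.
  have hsmall : ∀ᶠ t : ℝ in 𝓝[>] 0, ∀ j, t * x j < 1 := by
    refine eventually_all.2 fun j => nhdsWithin_le_nhds ?_
    have : Tendsto (fun t : ℝ => t * x j) (𝓝 0) (𝓝 (0 * x j)) := tendsto_id.mul_const _
    rw [zero_mul] at this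
    exact this.eventually (gt_mem_nhds one_pos)
  filter_upwards [hsmall, self_mem_nhdsWithin] with t ht ht0
  have ht0 : 0 < t := ht0
  set G := fun j => cdf (F.map (fun X : Fin d → ℝ => X j))
  have hpart : ∀ j, F.real {X | 1 - t * x j < G j (X j) ∧ G j (X j) ≤ 1 - t * y j}
      ≤ t * |x j - y j| := by
    intro j
    rcases le_or_gt (y j) (x j) with h | h
    · have hmeas : MeasurableSet {s | 1 - t * x j < G j s ∧ G j s ≤ 1 - t * y j} :=
        (measurableSet_lt measurable_const (monotone_cdf _).measurable).inter
          (measurableSet_le (monotone_cdf _).measurable measurable_const)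
      have h1 := measureReal_cdf_mem_Ioc_le (hc j) (a := 1 - t * x j) (b := 1 - t * y j)
        (by linarith [ht j]) (by nlinarith)
      rw [map_measureReal_apply (measurable_pi_apply j) hmeas] at h1
      refine h1.trans ?_
      rw [abs_of_nonneg (by linarith)]
      linarith
    · have : {X : Fin d → ℝ | 1 - t * x j < G j (X j) ∧ G j (X j) ≤ 1 - t * y j} = ∅ := by
        ext X
        simp only [Set.mem_ofPred_eq, Set.mem_empty_iff_false, iff_false, not_and, not_le]
        intro h'
        nlinarith
      rw [this, measureReal_empty]
      positivity
  -- An exceedance for `x` in coordinate `j` is either one for `y` or falls in the strip between the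
  -- two levels.
  have hsub : {X : Fin d → ℝ | ∃ j, 1 - t * x j < G j (X j)} ⊆ {X : Fin d → ℝ | ∃ j, 1 - t * y j < G j (X j)} ∪
      ⋃ j, {X : Fin d → ℝ | 1 - t * x j < G j (X j) ∧ G j (X j) ≤ 1 - t * y j} := by
    rintro X ⟨j, hj⟩
    rcases lt_or_ge (1 - t * y j) (G j (X j)) with h | h
    · exact Or.inl ⟨j, h⟩
    · exact Or.inr (Set.mem_iUnion.2 ⟨j, hj, h⟩)
  have hle : F.real {X : Fin d → ℝ | ∃ j, 1 - t * x j < G j (X j)} ≤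
      F.real {X : Fin d → ℝ | ∃ j, 1 - t * y j < G j (X j)} + ∑ j, t * |x j - y j| :=
    (measureReal_mono hsub).trans ((measureReal_union_le _ _).trans (add_le_add le_rfl
      ((measureReal_iUnion_fintype_le _).trans (Finset.sum_le_sum fun j _ => hpart j))))
  rw [← Finset.mul_sum] at hle
  rw [← mul_sub, inv_mul_le_iff₀ ht0]
  linarith

lemma IsStdf.abs_sub_le {d : ℕ} {l : (Fin d → ℝ) → ℝ} (hl : IsStdf d l) {x y : Fin d → ℝ}
    (hx : 0 ≤ x) (hy : 0 ≤ y) : |l x - l y| ≤ ∑ j, |x j - y j| := by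
  refine abs_sub_le_iff.2 ⟨hl.sub_le hx hy, (hl.sub_le hy hx).trans_eq ?_⟩
  exact Finset.sum_congr rfl fun j _ => abs_sub_comm _ _

/-! ### Moments of the binomial law -/

/-- The binomial weights are Bernstein polynomials evaluated at `p`, so the mean and variance can be
read off the known identities for these polynomials. -/
lemma integral_binomial_eq_sum_bernstein (n : ℕ) (p : unitInterval) (f : ℕ → ℝ) :
    ∫ t, f t ∂(binomial n p) =
      ∑ i ∈ Finset.range (n + 1), f i * (bernsteinPolynomial ℝ n i).eval (p : ℝ) := by
  rw [integral_binomial, Nat.range_succ_eq_Iic]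
  refine Finset.sum_congr rfl fun i _ => ?_
  simp only [bernsteinPolynomial, smul_eq_mul, Polynomial.eval_mul, Polynomial.eval_natCast,
    Polynomial.eval_pow, Polynomial.eval_X, Polynomial.eval_sub, Polynomial.eval_one]
  ring

lemma integral_binomial_natCast (n : ℕ) (p : unitInterval) :
    ∫ t, (t : ℝ) ∂(binomial n p) = n * p := by
  rw [integral_binomial_eq_sum_bernstein]
  have := congrArg (Polynomial.eval (p : ℝ)) (bernsteinPolynomial.sum_smul ℝ n)
  simpa [Polynomial.eval_finsetSum] using this

lemma integral_binomial_sq_sub (n : ℕ) (p : unitInterval) :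
    ∫ t, ((t : ℝ) - n * p) ^ 2 ∂(binomial n p) = n * p * (1 - p) := by
  rw [integral_binomial_eq_sum_bernstein]
  have := congrArg (Polynomial.eval (p : ℝ)) (bernsteinPolynomial.variance ℝ n)
  simp only [Polynomial.eval_finsetSum, Polynomial.eval_mul, Polynomial.eval_pow,
    Polynomial.eval_sub, Polynomial.eval_X, Polynomial.eval_natCast,
    Polynomial.eval_one, nsmul_eq_mul] at this
  rw [← this]
  refine Finset.sum_congr rfl fun i _ => ?_
  ring

lemma integral_binomial_exp (n : ℕ) (p : unitInterval) (s : ℝ) :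
    ∫ t, Real.exp (s * t) ∂(binomial n p) = (p * Real.exp s + (1 - p)) ^ n := by
  rw [integral_binomial, add_pow, Nat.range_succ_eq_Iic]
  refine Finset.sum_congr rfl fun i _ => ?_
  rw [mul_comm s, Real.exp_nat_mul, mul_pow, smul_eq_mul]
  ring

lemma ae_binomial_le (n : ℕ) (p : unitInterval) : ∀ᵐ t ∂(binomial n p), t ≤ n :=
  ae_le_of_hasLaw_binomial (X := id) (HasLaw.id)

/-! ### The beta smoother -/

lemma integrable_of_ae_mem_finite {A E : Type*} [MeasurableSpace A] [MeasurableSingletonClass A]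
    [NormedAddCommGroup E] {μ : Measure A} [IsFiniteMeasure μ] {S : Set A} (hS : S.Finite)
    (h : ∀ᵐ y ∂μ, y ∈ S) (f : A → E) : Integrable f μ := by
  rw [← Measure.restrict_eq_self_of_ae_mem h]
  exact IntegrableOn.of_finite hS

section BetaSmoother

variable {d n : ℕ} {k : ℝ} {x : Fin d → ℝ}

instance : IsProbabilityMeasure (betaSmoother n k x) := by
  unfold betaSmoother
  have : ∀ j, IsProbabilityMeasure ((binomial n (Set.projIcc (0 : ℝ) 1 zero_le_one
      (k / n * x j))).map (fun t : ℕ => (t : ℝ) / k)) := fun j =>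
    Measure.isProbabilityMeasure_map (by fun_prop)
  infer_instance

lemma measurePreserving_betaSmoother (j : Fin d) :
    MeasurePreserving (fun y : Fin d → ℝ => y j) (betaSmoother n k x)
      ((binomial n (Set.projIcc (0 : ℝ) 1 zero_le_one (k / n * x j))).map
        (fun t : ℕ => (t : ℝ) / k)) := by
  have : ∀ j, IsProbabilityMeasure ((binomial n (Set.projIcc (0 : ℝ) 1 zero_le_one
      (k / n * x j))).map (fun t : ℕ => (t : ℝ) / k)) := fun j =>
    Measure.isProbabilityMeasure_map (by fun_prop)
  exact measurePreserving_eval _ j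

/-- The grid carrying the beta smoother. -/
def grid (d n : ℕ) (k : ℝ) : Set (Fin d → ℝ) :=
  Set.univ.pi fun _ => (fun t : ℕ => (t : ℝ) / k) '' Set.Iic n

lemma finite_grid : (grid d n k).Finite :=
  Set.Finite.pi fun _ => (Set.finite_Iic n).image _

lemma ae_mem_grid : ∀ᵐ y ∂(betaSmoother n k x), y ∈ grid d n k := by
  simp only [grid, Set.mem_univ_pi]
  refine ae_all_iff.2 fun j => ?_
  refine (measurePreserving_betaSmoother j).quasiMeasurePreserving.ae
    (p := fun s => s ∈ (fun t : ℕ => (t : ℝ) / k) '' Set.Iic n) ?_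
  refine (ae_map_iff (by fun_prop) (((Set.finite_Iic n).image
    (fun t : ℕ => (t : ℝ) / k)).measurableSet)).2 ?_
  filter_upwards [ae_binomial_le n _] with t ht using ⟨t, ht, rfl⟩

lemma grid_subset_cube (hk : 0 < k) : grid d n k ⊆ cube d ((n : ℝ) / k) := by
  intro y hy
  simp only [grid, Set.mem_univ_pi] at hy
  refine ⟨fun j => ?_, fun j => ?_⟩ <;> obtain ⟨t, ht, hy⟩ := hy j <;> rw [← hy]
  · exact div_nonneg t.cast_nonneg hk.le
  · have : (t : ℝ) ≤ n := by exact_mod_cast ht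
    exact div_le_div_of_nonneg_right this hk.le

lemma ae_mem_cube (hk : 0 < k) : ∀ᵐ y ∂(betaSmoother n k x), y ∈ cube d ((n : ℝ) / k) := by
  filter_upwards [ae_mem_grid] with y hy using grid_subset_cube hk hy

/-- Finite support replaces measurability, which the pilot estimator is not assumed to have. -/
lemma integrable_betaSmoother (f : (Fin d → ℝ) → ℝ) : Integrable f (betaSmoother n k x) :=
  integrable_of_ae_mem_finite finite_grid ae_mem_grid f

lemma betaSmooth_eq_integral (hk : 0 < k) (g : (Fin d → ℝ) → ℝ) :
    betaSmooth n k g x = ∫ y, g y ∂(betaSmoother n k x) := by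
  rw [betaSmooth, Measure.restrict_eq_self_of_ae_mem (ae_mem_cube hk)]

lemma integral_betaSmoother_coord (j : Fin d) {f : ℝ → ℝ} (hf : Measurable f) :
    ∫ y, f (y j) ∂(betaSmoother n k x) =
      ∫ t : ℕ, f (t / k) ∂(binomial n (Set.projIcc (0 : ℝ) 1 zero_le_one (k / n * x j))) := by
  have h := measurePreserving_betaSmoother (n := n) (k := k) (x := x) j
  rw [← integral_map (f := f) (φ := fun y : Fin d → ℝ => y j) h.measurable.aemeasurable
    hf.aestronglyMeasurable, h.map_eq, integral_map (by fun_prop) hf.aestronglyMeasurable]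

lemma coe_projIcc_betaSmoother (hk : 0 < k) (hkn : k ≤ n) (hx : x ∈ cube d 1) (j : Fin d) :
    ((Set.projIcc (0 : ℝ) 1 zero_le_one (k / n * x j) : unitInterval) : ℝ) = k / n * x j := by
  have hn : (0 : ℝ) < n := hk.trans_le hkn
  rw [Set.projIcc_of_mem]
  have h0 : 0 ≤ x j := hx.1 j
  have h1 : x j ≤ 1 := hx.2 j
  exact ⟨by positivity, mul_le_one₀ ((div_le_one hn).2 hkn) h0 h1⟩

lemma integral_betaSmoother_apply (hk : 0 < k) (hkn : k ≤ n) (hx : x ∈ cube d 1) (j : Fin d) :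
    ∫ y, y j ∂(betaSmoother n k x) = x j := by
  have hn : (0 : ℝ) < n := hk.trans_le hkn
  rw [integral_betaSmoother_coord j (f := fun s => s) measurable_id, integral_div,
    integral_binomial_natCast, coe_projIcc_betaSmoother hk hkn hx]
  field_simp

lemma integral_betaSmoother_sq_sub_le (hk : 0 < k) (hkn : k ≤ n) (hx : x ∈ cube d 1)
    (j : Fin d) : ∫ y, (y j - x j) ^ 2 ∂(betaSmoother n k x) ≤ x j / k := by
  have hn : (0 : ℝ) < n := hk.trans_le hkn
  have h0 : 0 ≤ x j := hx.1 j
  set p := (Set.projIcc (0 : ℝ) 1 zero_le_one (k / n * x j) : unitInterval) with hp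
  have hp' : (p : ℝ) = k / n * x j := coe_projIcc_betaSmoother hk hkn hx j
  rw [integral_betaSmoother_coord j (f := fun s => (s - x j) ^ 2) (by fun_prop)]
  have : ∀ t : ℕ, ((t : ℝ) / k - x j) ^ 2 = ((t : ℝ) - n * p) ^ 2 / k ^ 2 := by
    intro t
    rw [hp']
    field_simp
  simp_rw [this]
  rw [integral_div, integral_binomial_sq_sub, hp', div_le_div_iff₀ (by positivity) hk]
  have h1 : n * (k / n * x j) = k * x j := by field_simp
  rw [h1]
  have : 0 ≤ k / n * x j := by positivity
  have h2 : 0 ≤ k * x j * k * (k / n * x j) := by positivity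
  nlinarith

/-- Jensen's inequality and the variance bound. Keeping `x j` under the root is essential: it makes
the deviation small near the faces where differentiability may fail. -/
lemma integral_betaSmoother_abs_sub_le (hk : 0 < k) (hkn : k ≤ n) (hx : x ∈ cube d 1)
    (j : Fin d) : ∫ y, |y j - x j| ∂(betaSmoother n k x) ≤ √(x j / k) := by
  refine Real.le_sqrt_of_sq_le ?_
  refine le_trans ?_ (integral_betaSmoother_sq_sub_le hk hkn hx j)
  have := ConvexOn.map_integral_le (μ := betaSmoother n k x) (s := Set.univ)
    (g := fun s : ℝ => s ^ 2) (f := fun y => |y j - x j|) (Even.convexOn_pow even_two)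
    (by fun_prop) isClosed_univ (by simp) (integrable_betaSmoother _) (integrable_betaSmoother _)
  simpa only [sq_abs, Function.comp_def] using this

/-- The Chernoff bound for one coordinate of the beta smoother. -/
lemma measureReal_betaSmoother_coord_ge_le (hk : 0 < k) (hkn : k ≤ n) (hx : x ∈ cube d 1)
    (j : Fin d) {δ s : ℝ} (hs : 0 ≤ s) (hs1 : s ≤ 1) :
    (betaSmoother n k x).real {y | 1 + δ ≤ y j} ≤ Real.exp (-(s * (δ - s)) * k) := by
  have hn : (0 : ℝ) < n := hk.trans_le hkn
  have h0 : 0 ≤ x j := hx.1 j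
  have h1 : x j ≤ 1 := hx.2 j
  have hch := measure_ge_le_exp_mul_mgf (μ := betaSmoother n k x) (X := fun y => y j)
    (t := s * k) (1 + δ) (by positivity) (integrable_betaSmoother _)
  refine hch.trans ?_
  set p := (Set.projIcc (0 : ℝ) 1 zero_le_one (k / n * x j) : unitInterval) with hp
  have hp' : (p : ℝ) = k / n * x j := coe_projIcc_betaSmoother hk hkn hx j
  have hmgf : mgf (fun y => y j) (betaSmoother n k x) (s * k) =
      (p * Real.exp s + (1 - p)) ^ n := by
    rw [mgf, integral_betaSmoother_coord j (f := fun r => Real.exp (s * k * r)) (by fun_prop),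
      ← integral_binomial_exp]
    refine integral_congr_ae (Eventually.of_forall fun t => ?_)
    simp only
    congr 1
    field_simp
  -- The restriction `s ≤ 1` serves this quadratic bound on the exponential.
  have hexp : Real.exp s - 1 ≤ s + s ^ 2 := by
    have := Real.abs_exp_sub_one_sub_id_le (x := s) (by rwa [abs_of_nonneg hs])
    linarith [(abs_le.1 this).2]
  have hp0 : (0 : ℝ) ≤ p := p.2.1
  have hp1 : (p : ℝ) ≤ 1 := p.2.2
  have hpow : (p * Real.exp s + (1 - p)) ^ n ≤ Real.exp (k * (s + s ^ 2)) := by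
    calc (p * Real.exp s + (1 - p)) ^ n ≤ Real.exp (p * (s + s ^ 2)) ^ n := by
          refine pow_le_pow_left₀ (by have := Real.exp_pos s; nlinarith [mul_nonneg hp0 this.le]) ?_ n
          have := Real.add_one_le_exp ((p : ℝ) * (s + s ^ 2))
          nlinarith [mul_le_mul_of_nonneg_left hexp hp0]
      _ = Real.exp (n * (p * (s + s ^ 2))) := (Real.exp_nat_mul _ _).symm
      _ ≤ Real.exp (k * (s + s ^ 2)) := by
          refine Real.exp_le_exp.2 ?_
          have : n * ((p : ℝ) * (s + s ^ 2)) = x j * (k * (s + s ^ 2)) := by rw [hp']; field_simp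
          rw [this]
          exact mul_le_of_le_one_left (by positivity) h1
  rw [hmgf]
  calc Real.exp (-(s * k) * (1 + δ)) * (p * Real.exp s + (1 - p)) ^ n
      ≤ Real.exp (-(s * k) * (1 + δ)) * Real.exp (k * (s + s ^ 2)) :=
        mul_le_mul_of_nonneg_left hpow (Real.exp_pos _).le
    _ = Real.exp (-(s * (δ - s)) * k) := by rw [← Real.exp_add]; congr 1; ring

/-- The beta smoother has exponentially small mass outside a neighbourhood of `[0, 1]^d`. -/
lemma measureReal_betaSmoother_compl_cube_le (hk : 0 < k) (hkn : k ≤ n) (hx : x ∈ cube d 1)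
    {δ s : ℝ} (hs : 0 ≤ s) (hs1 : s ≤ 1) :
    (betaSmoother n k x).real (cube d (1 + δ))ᶜ ≤ d * Real.exp (-(s * (δ - s)) * k) := by
  have hle : (betaSmoother n k x).real (cube d (1 + δ))ᶜ ≤
      (betaSmoother n k x).real (⋃ j, {y | 1 + δ ≤ y j}) := by
    refine ENNReal.toReal_mono (measure_ne_top _ _) (measure_mono_ae ?_)
    filter_upwards [ae_mem_cube (x := x) hk] with y hy hy'
    by_contra hcon
    refine hy' ⟨hy.1, fun j => ?_⟩
    by_contra h
    exact hcon (Set.mem_iUnion.2 ⟨j, (not_le.1 h).le⟩)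
  refine hle.trans ((measureReal_iUnion_fintype_le _).trans ?_)
  refine (Finset.sum_le_sum fun j _ =>
    measureReal_betaSmoother_coord_ge_le hk hkn hx j (δ := δ) hs hs1).trans ?_
  simp

end BetaSmoother

/-! ### The bias of the beta smoother -/

section Bias

variable {d : ℕ} {l : (Fin d → ℝ) → ℝ}

lemma sum_abs_update_sub (z : Fin d → ℝ) (j : Fin d) (s t : ℝ) :
    ∑ i, |Function.update z j s i - Function.update z j t i| = |s - t| := by
  rw [Finset.sum_eq_single j]
  · simp
  · intro i _ hi
    simp [Function.update_of_ne hi]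
  · simp

lemma update_nonneg {z : Fin d → ℝ} (hz : 0 ≤ z) (j : Fin d) {s : ℝ} (hs : 0 ≤ s) :
    0 ≤ Function.update z j s := by
  intro i
  rcases eq_or_ne i j with rfl | h
  · simpa using hs
  · simpa [Function.update_of_ne h] using hz i

lemma IsStdf.abs_deriv_le_one (hl : IsStdf d l) {x : Fin d → ℝ} (hx : 0 ≤ x) {j : Fin d}
    (hj : 0 < x j) {a : ℝ} (ha : HasDerivAt (fun s : ℝ => l (Function.update x j s)) a (x j)) :
    |a| ≤ 1 := by
  have := ha.hasFDerivAt.le_of_lip' zero_le_one (by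
    filter_upwards [lt_mem_nhds hj] with s hs
    rw [one_mul, Real.norm_eq_abs, Real.norm_eq_abs]
    refine (hl.abs_sub_le (update_nonneg hx j hs.le) (update_nonneg hx j hj.le)).trans_eq ?_
    exact sum_abs_update_sub x j s (x j))
  simpa using this

lemma dist_sq_le_sum_sq (x y : Fin d → ℝ) : dist x y ^ 2 ≤ ∑ j, (y j - x j) ^ 2 := by
  have h0 : 0 ≤ ∑ j, (y j - x j) ^ 2 := Finset.sum_nonneg fun j _ => sq_nonneg _
  refine (Real.le_sqrt dist_nonneg h0).1 ((dist_pi_le_iff (Real.sqrt_nonneg _)).2 fun j => ?_)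
  rw [dist_comm, Real.dist_eq]
  exact Real.abs_le_sqrt (Finset.single_le_sum (f := fun j => (y j - x j) ^ 2)
    (fun j _ => sq_nonneg _) (Finset.mem_univ j))

/-- A first-order expansion of an stdf, uniform over `[0, 1]^d`. The coordinates close to zero,
where the partial derivatives need not be continuous, are treated separately. -/
lemma IsStdf.exists_expansion (hl : IsStdf d l) (hs : HasContPartials d l) {ε τ : ℝ} (hε : 0 < ε)
    (hτ : 0 < τ) : ∃ C : ℝ, 0 ≤ C ∧ ∀ x ∈ cube d 1, ∃ a : Fin d → ℝ, ∀ y : Fin d → ℝ, 0 ≤ y →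
      |l y - l x - ∑ j, a j * (y j - x j)| ≤
        ∑ j, (ε + if x j < 2 * τ then 1 else 0) * |y j - x j| + C * ∑ j, (y j - x j) ^ 2 := by
  choose l' hcont hder using hs
  -- The sets are larger than needed for `x` alone: as `η < 1` and `η < τ`, points within `η` of an
  -- `x ∈ [0,1]^d` with `2 * τ ≤ x j` stay in them.
  have hK : ∀ j, IsCompact {x : Fin d → ℝ | x ∈ cube d 2 ∧ τ ≤ x j} := fun j =>
    isCompact_Icc.inter_right (isClosed_le continuous_const (continuous_apply j))
  have huc : ∀ j, ∃ η > 0, ∀ x ∈ {x : Fin d → ℝ | x ∈ cube d 2 ∧ τ ≤ x j},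
      ∀ y ∈ {x : Fin d → ℝ | x ∈ cube d 2 ∧ τ ≤ x j}, dist x y < η →
        dist (l' j x) (l' j y) < ε := fun j =>
    Metric.uniformContinuousOn_iff.1 ((hK j).uniformContinuousOn_of_continuous
      ((hcont j).mono fun x hx => ⟨hx.1.1, hτ.trans_le hx.2⟩)) ε hε
  choose η' hη' huc using huc
  obtain ⟨η, ⟨⟨hη1, hητ⟩, hηj⟩, hη⟩ : ∃ η : ℝ, ((η < 1 ∧ η < τ) ∧ ∀ j, η < η' j) ∧ 0 < η := by
    have h1 : ∀ᶠ η : ℝ in 𝓝[>] 0, ((η < 1 ∧ η < τ) ∧ ∀ j, η < η' j) ∧ 0 < η := by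
      refine Eventually.and (nhdsWithin_le_nhds ?_) self_mem_nhdsWithin
      exact ((gt_mem_nhds one_pos).and (gt_mem_nhds hτ)).and
        (eventually_all.2 fun j => gt_mem_nhds (hη' j))
    exact h1.exists
  -- This constant pays for `dist x y ≥ η`: both the increment and the linear term are at most `∑ |y
  -- j - x j|`, and each summand is at most the sum of squares divided by `η`.
  refine ⟨2 * d / η, by positivity, fun x hx => ?_⟩
  have hx0 : 0 ≤ x := hx.1
  have hx1 : ∀ j, x j ≤ 1 := fun j => hx.2 j
  refine ⟨fun j => if x j < 2 * τ then 0 else l' j x, fun y hy => ?_⟩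
  set a : Fin d → ℝ := fun j => if x j < 2 * τ then 0 else l' j x with ha
  set c : Fin d → ℝ := fun j => ε + if x j < 2 * τ then 1 else 0 with hc
  have ha1 : ∀ j, |a j| ≤ 1 := by
    intro j
    simp only [ha]
    split_ifs with h
    · simp
    · have hj : 0 < x j := by linarith
      exact hl.abs_deriv_le_one hx0 hj (hder j x hx0 hj)
  have hc0 : ∀ j, 0 ≤ c j := fun j => by
    simp only [hc]
    split_ifs <;> positivity
  have hsq0 : 0 ≤ ∑ j, (y j - x j) ^ 2 := Finset.sum_nonneg fun j _ => sq_nonneg _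
  have hcoord : ∀ j, |y j - x j| ≤ dist x y := fun j => by
    rw [← Real.dist_eq, dist_comm]
    exact dist_le_pi_dist x y j
  rcases le_or_gt η (dist x y) with hfar | hnear
  · have h1 : |l y - l x - ∑ j, a j * (y j - x j)| ≤ 2 * ∑ j, |y j - x j| := by
      have h2 : |∑ j, a j * (y j - x j)| ≤ ∑ j, |y j - x j| := by
        refine (Finset.abs_sum_le_sum_abs _ _).trans (Finset.sum_le_sum fun j _ => ?_)
        rw [abs_mul]
        exact mul_le_of_le_one_left (abs_nonneg _) (ha1 j)
      have := abs_sub (l y - l x) (∑ j, a j * (y j - x j))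
      linarith [hl.abs_sub_le hy hx0]
    have h3 : ∑ j, |y j - x j| ≤ d * ((∑ j, (y j - x j) ^ 2) / η) := by
      refine (Finset.sum_le_card_nsmul _ _ ((∑ j, (y j - x j) ^ 2) / η) fun j _ => ?_).trans_eq
        (by simp)
      refine (hcoord j).trans ((le_div_iff₀ hη).2 ?_)
      have := dist_sq_le_sum_sq x y
      nlinarith [dist_nonneg (x := x) (y := y)]
    have h4 : 0 ≤ ∑ j, c j * |y j - x j| :=
      Finset.sum_nonneg fun j _ => mul_nonneg (hc0 j) (abs_nonneg _)
    calc _ ≤ 2 * (d * ((∑ j, (y j - x j) ^ 2) / η)) := h1.trans (by linarith)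
      _ = 2 * d / η * ∑ j, (y j - x j) ^ 2 := by ring
      _ ≤ _ := le_add_of_nonneg_left h4
  -- One coordinate is moved from `x j` to `y j`, at a point `z` mixing coordinates of `x` and `y`.
  -- For small `x j` the Lipschitz bound suffices; otherwise the mean value inequality is applied
  -- after subtracting the linear function with slope `l' j x`.
  have hstep : ∀ (z : Fin d → ℝ) (j : Fin d), (∀ i, z i = x i ∨ z i = y i) → z j = x j →
      |l (Function.update z j (y j)) - l z - a j * (y j - x j)| ≤ c j * |y j - x j| := by
    intro z j hz hzj
    have hz0 : 0 ≤ z := fun i => by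
      rcases hz i with h | h <;> rw [h]
      exacts [hx0 i, hy i]
    have hzeq : z = Function.update z j (x j) := by rw [← hzj, Function.update_eq_self]
    by_cases hxj : x j < 2 * τ
    · have h1 : a j = 0 := if_pos hxj
      have h2 : c j = ε + 1 := by simp only [hc, if_pos hxj]
      rw [h1, h2, zero_mul, sub_zero]
      have h3 := hl.abs_sub_le (update_nonneg hz0 j (hy j)) (update_nonneg hz0 j (hx0 j))
      rw [sum_abs_update_sub, ← hzeq] at h3
      nlinarith [abs_nonneg (y j - x j)]
    · have h1 : a j = l' j x := if_neg hxj
      have h2 : c j = ε := by simp only [hc, if_neg hxj, add_zero]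
      rw [h1, h2]
      have hxj' : 2 * τ ≤ x j := not_lt.1 hxj
      have hmem : ∀ s ∈ Set.uIcc (x j) (y j), |s - x j| ≤ |y j - x j| := fun s hs =>
        Set.abs_sub_left_of_mem_uIcc hs
      have hτs : ∀ s ∈ Set.uIcc (x j) (y j), τ ≤ s := fun s hs => by
        have := (abs_le.1 ((hmem s hs).trans (hcoord j))).1
        linarith
      have hbd : ∀ s ∈ Set.uIcc (x j) (y j), |l' j (Function.update z j s) - l' j x| ≤ ε := by
        intro s hs
        have hcl : ∀ i, |Function.update z j s i - x i| < η := by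
          intro i
          refine lt_of_le_of_lt ?_ hnear
          rcases eq_or_ne i j with rfl | h
          · simpa using (hmem s hs).trans (hcoord i)
          · rw [Function.update_of_ne h]
            rcases hz i with h | h <;> rw [h]
            · simp
            · exact hcoord i
        refine (huc j _ ⟨⟨update_nonneg hz0 j (hτ.le.trans (hτs s hs)), fun i => ?_⟩, ?_⟩ x
          ⟨⟨hx0, fun i => (hx1 i).trans one_le_two⟩, by linarith⟩ ?_).le
        · have := (abs_lt.1 (hcl i)).2
          linarith [hx1 i]
        · simpa using hτs s hs
        · refine ((dist_pi_lt_iff hη).2 fun i => ?_).trans (hηj j)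
          rw [Real.dist_eq]
          exact hcl i
      have hd : ∀ s ∈ Set.uIcc (x j) (y j), HasDerivWithinAt
          (fun s => l (Function.update z j s) - l' j x * s)
          (l' j (Function.update z j s) - l' j x) (Set.uIcc (x j) (y j)) s := by
        intro s hs
        have hs0 : 0 < s := hτ.trans_le (hτs s hs)
        have h3 := hder j (Function.update z j s) (update_nonneg hz0 j hs0.le) (by simpa using hs0)
        simp only [Function.update_idem, Function.update_self] at h3
        have h4 : HasDerivAt (fun s => l' j x * s) (l' j x) s := by
          simpa using (hasDerivAt_id s).const_mul (l' j x)
        exact (h3.sub h4).hasDerivWithinAt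
      have h5 := Convex.norm_image_sub_le_of_norm_hasDerivWithin_le hd hbd (convex_uIcc _ _)
        Set.left_mem_uIcc Set.right_mem_uIcc
      simp only [Real.norm_eq_abs, ← hzeq] at h5
      refine le_trans (le_of_eq ?_) h5
      congr 1
      ring
  have htel : ∀ s : Finset (Fin d), |l (s.piecewise y x) - l x - ∑ j ∈ s, a j * (y j - x j)| ≤
      ∑ j ∈ s, c j * |y j - x j| := by
    intro s
    induction s using Finset.induction_on with
    | empty => simp
    | insert j s hj ih =>
      rw [Finset.sum_insert hj, Finset.sum_insert hj, Finset.piecewise_insert]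
      have h := hstep (s.piecewise y x) j (fun i => by
        by_cases hi : i ∈ s
        · exact Or.inr (Finset.piecewise_eq_of_mem _ _ _ hi)
        · exact Or.inl (Finset.piecewise_eq_of_notMem _ _ _ hi))
        (Finset.piecewise_eq_of_notMem _ _ _ hj)
      refine le_trans (le_trans (le_of_eq ?_) (abs_add_le _ _)) (add_le_add h ih)
      congr 1
      ring
  have h := htel Finset.univ
  rw [Finset.piecewise_univ] at h
  exact h.trans (le_add_of_nonneg_right (by positivity))

/-- The bias of the beta smoother is of smaller order than `1 / √k`, uniformly over `[0, 1]^d`. -/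
lemma IsStdf.exists_bias_bound (hl : IsStdf d l) (hs : HasContPartials d l) {ε : ℝ} (hε : 0 < ε) :
    ∃ C : ℝ, 0 ≤ C ∧ ∀ (n : ℕ) (k : ℝ), 0 < k → k ≤ n → ∀ x ∈ cube d 1,
      √k * |∫ y, (l y - l x) ∂(betaSmoother n k x)| ≤ ε + C / √k := by
  set e := ε / (2 * (d + 1)) with he
  have he0 : 0 < e := by positivity
  -- With `2 * τ = e ^ 2`, the condition `x j < 2 * τ` gives `√(x j) ≤ e`, so `(e + 1) * √(x j) ≤ 2
  -- * e`; the choice of `e` makes the sum over the `d` coordinates at most `ε`.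
  obtain ⟨C, hC, hexp⟩ := hl.exists_expansion hs (ε := e) (τ := e ^ 2 / 2) he0 (by positivity)
  refine ⟨C * d, by positivity, fun n k hk hkn x hx => ?_⟩
  obtain ⟨a, ha⟩ := hexp x hx
  set μ := betaSmoother n k x
  have hint : ∀ f : (Fin d → ℝ) → ℝ, Integrable f μ := integrable_betaSmoother
  have hx0 : ∀ j, 0 ≤ x j := fun j => hx.1 j
  have hx1 : ∀ j, x j ≤ 1 := fun j => hx.2 j
  have hlin : ∫ y, ∑ j, a j * (y j - x j) ∂μ = 0 := by
    rw [integral_finsetSum _ fun j _ => hint _]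
    refine Finset.sum_eq_zero fun j _ => ?_
    rw [integral_const_mul, integral_sub (hint _) (hint _),
      integral_betaSmoother_apply hk hkn hx, integral_const]
    simp
  have hk' : 0 < √k := Real.sqrt_pos.2 hk
  have hterm : ∀ j, (e + if x j < 2 * (e ^ 2 / 2) then 1 else 0) * √(x j / k) ≤ 2 * e / √k := by
    intro j
    rw [Real.sqrt_div (hx0 j), ← mul_div_assoc]
    refine div_le_div_of_nonneg_right ?_ hk'.le
    have h1 : √(x j) ≤ 1 := Real.sqrt_le_one.2 (hx1 j)
    have h0 := Real.sqrt_nonneg (x j)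
    split_ifs with h
    · have h2 : √(x j) ≤ e := Real.sqrt_le_iff.2 ⟨he0.le, by linarith⟩
      nlinarith
    · nlinarith
  have hmain : |∫ y, (l y - l x) ∂μ| ≤ d * (2 * e / √k) + C * (d * (1 / k)) := by
    calc |∫ y, (l y - l x) ∂μ| = |∫ y, (l y - l x - ∑ j, a j * (y j - x j)) ∂μ| := by
          rw [integral_sub (hint fun y => l y - l x) (hint _), hlin, sub_zero]
      _ ≤ ∫ y, |l y - l x - ∑ j, a j * (y j - x j)| ∂μ := abs_integral_le_integral_abs
      _ ≤ ∫ y, (∑ j, (e + if x j < 2 * (e ^ 2 / 2) then 1 else 0) * |y j - x j| +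
            C * ∑ j, (y j - x j) ^ 2) ∂μ := by
          refine integral_mono_ae (hint _) (hint _) ?_
          filter_upwards [ae_mem_cube hk] with y hy using ha y hy.1
      _ = ∑ j, (e + if x j < 2 * (e ^ 2 / 2) then 1 else 0) * ∫ y, |y j - x j| ∂μ +
            C * ∑ j, ∫ y, (y j - x j) ^ 2 ∂μ := by
          rw [integral_add (hint _) (hint _), integral_finsetSum _ fun j _ => hint _,
            integral_const_mul, integral_finsetSum _ fun j _ => hint _]
          simp_rw [integral_const_mul]
      _ ≤ ∑ j : Fin d, 2 * e / √k + C * ∑ j : Fin d, 1 / k := by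
          refine add_le_add (Finset.sum_le_sum fun j _ => ?_)
            (mul_le_mul_of_nonneg_left (Finset.sum_le_sum fun j _ => ?_) hC)
          · refine le_trans (mul_le_mul_of_nonneg_left
              (integral_betaSmoother_abs_sub_le hk hkn hx j) ?_) (hterm j)
            split_ifs <;> positivity
          · exact (integral_betaSmoother_sq_sub_le hk hkn hx j).trans
              (div_le_div_of_nonneg_right (hx1 j) hk.le)
      _ = _ := by simp
  have hkk : √k * √k = k := Real.mul_self_sqrt hk.le
  calc √k * |∫ y, (l y - l x) ∂μ| ≤ √k * (d * (2 * e / √k) + C * (d * (1 / k))) :=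
        mul_le_mul_of_nonneg_left hmain hk'.le
    _ = d * (2 * e) + C * d / √k := by
        nth_rw 3 [← hkk]
        field_simp
    _ ≤ ε + C * d / √k := by
        refine add_le_add ?_ le_rfl
        have : (2 * ((d : ℝ) + 1)) * e = ε := by rw [he]; field_simp
        nlinarith

end Bias

/-! ### Outer expectations -/

section OuterExp

lemma outerExp_nonneg {A : Type*} [MeasurableSpace A] {P : Measure A} {f : A → ℝ}
    (h : ∀ ω, 0 ≤ f ω) : 0 ≤ outerExp P f := by
  -- This also covers the absence of integrable majorants, since the real infimum of the empty set
  -- is `0`.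
  refine Real.sInf_nonneg ?_
  rintro r ⟨U, -, -, hfU, rfl⟩
  exact integral_nonneg fun ω => (h ω).trans (hfU ω)

variable {A : Type*} [MeasurableSpace A] {P : Measure A} [IsProbabilityMeasure P] {f g : A → ℝ}

lemma outerExp_le_integral {c : ℝ} (hf : ∀ ω, c ≤ f ω) {U : A → ℝ} (hU : Measurable U)
    (hUi : Integrable U P) (hfU : ∀ ω, f ω ≤ U ω) : outerExp P f ≤ ∫ ω, U ω ∂P := by
  refine csInf_le ⟨c, ?_⟩ ⟨U, hU, hUi, hfU, rfl⟩
  rintro r ⟨V, -, hVi, hfV, rfl⟩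
  calc c = ∫ _, c ∂P := by simp
    _ ≤ ∫ ω, V ω ∂P := integral_mono (integrable_const c) hVi fun ω => (hf ω).trans (hfV ω)

lemma exists_integral_lt_of_outerExp_lt {C r : ℝ} (hf : ∀ ω, f ω ≤ C) (h : outerExp P f < r) :
    ∃ U : A → ℝ, Measurable U ∧ Integrable U P ∧ (∀ ω, f ω ≤ U ω) ∧ ∫ ω, U ω ∂P < r := by
  have hne : {r : ℝ | ∃ U : A → ℝ, Measurable U ∧ Integrable U P ∧ (∀ ω, f ω ≤ U ω) ∧
      r = ∫ ω, U ω ∂P}.Nonempty :=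
    ⟨∫ _, C ∂P, fun _ => C, measurable_const, integrable_const C, hf, rfl⟩
  obtain ⟨_, ⟨U, hU, hUi, hfU, rfl⟩, hlt⟩ := exists_lt_of_csInf_lt hne h
  exact ⟨U, hU, hUi, hfU, hlt⟩

lemma outerExp_mono {c C : ℝ} (hf : ∀ ω, c ≤ f ω) (hg : ∀ ω, g ω ≤ C) (hfg : ∀ ω, f ω ≤ g ω) :
    outerExp P f ≤ outerExp P g := by
  refine le_of_forall_gt fun r hr => ?_
  obtain ⟨U, hU, hUi, hgU, hlt⟩ := exists_integral_lt_of_outerExp_lt hg hr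
  exact (outerExp_le_integral hf hU hUi fun ω => (hfg ω).trans (hgU ω)).trans_lt hlt

lemma outerExp_add_le {c C c' C' : ℝ} (hf : ∀ ω, c ≤ f ω) (hf' : ∀ ω, f ω ≤ C)
    (hg : ∀ ω, c' ≤ g ω) (hg' : ∀ ω, g ω ≤ C') :
    outerExp P (fun ω => f ω + g ω) ≤ outerExp P f + outerExp P g := by
  refine le_of_forall_pos_le_add fun ε hε => ?_
  obtain ⟨U, hU, hUi, hfU, hlt⟩ := exists_integral_lt_of_outerExp_lt (P := P) hf'
    (lt_add_of_pos_right _ (half_pos hε))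
  obtain ⟨V, hV, hVi, hgV, hlt'⟩ := exists_integral_lt_of_outerExp_lt (P := P) hg'
    (lt_add_of_pos_right _ (half_pos hε))
  have := outerExp_le_integral (P := P) (f := fun ω => f ω + g ω)
    (fun ω => add_le_add (hf ω) (hg ω)) (hU.add hV) (hUi.add hVi)
    fun ω => add_le_add (hfU ω) (hgV ω)
  simp only [Pi.add_apply] at this
  rw [integral_add hUi hVi] at this
  linarith

/-- Inner expectation is at most outer expectation, by subadditivity applied to `f + (-f) = 0`. -/
lemma neg_outerExp_neg_le {c C : ℝ} (hf : ∀ ω, c ≤ f ω) (hf' : ∀ ω, f ω ≤ C) :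
    -outerExp P (fun ω => -f ω) ≤ outerExp P f := by
  have h1 := outerExp_add_le (P := P) hf hf' (g := fun ω => -f ω)
    (fun ω => neg_le_neg (hf' ω)) (fun ω => neg_le_neg (hf ω))
  have h2 : 0 ≤ outerExp P (fun ω => f ω + -f ω) := outerExp_nonneg fun ω => by simp
  linarith

/-- Markov's inequality for outer expectations. -/
lemma measure_le_of_outerExp_lt {C r : ℝ} (h0 : ∀ ω, 0 ≤ f ω) (hf : ∀ ω, f ω ≤ C)
    (h : outerExp P f < r) : P {ω | 1 ≤ f ω} ≤ ENNReal.ofReal r := by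
  obtain ⟨U, hU, hUi, hfU, hlt⟩ := exists_integral_lt_of_outerExp_lt hf h
  have h1 := mul_meas_ge_le_integral_of_nonneg
    (Eventually.of_forall fun ω => (h0 ω).trans (hfU ω)) hUi 1
  rw [one_mul] at h1
  calc P {ω | 1 ≤ f ω} ≤ P {ω | 1 ≤ U ω} := measure_mono fun ω hω => le_trans hω (hfU ω)
    _ = ENNReal.ofReal (P.real {ω | 1 ≤ U ω}) := (ofReal_measureReal).symm
    _ ≤ ENNReal.ofReal r := ENNReal.ofReal_le_ofReal (h1.trans hlt.le)

lemma outerExp_min_le {Z : A → ℝ} (hZ : ∀ ω, 0 ≤ Z ω) {ε C m : ℝ} (hε : 0 ≤ ε) (hm : 0 ≤ m)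
    (hC : 0 ≤ C) :
    outerExp P (fun ω => min (m * Z ω) C) ≤ m * ε + C * P.real {ω | ε ≤ Z ω} := by
  -- The measurable hull has the same outer probability and yields a measurable majorant.
  set D := toMeasurable P {ω | ε ≤ Z ω}
  have hD : MeasurableSet D := measurableSet_toMeasurable _ _
  have hi : Integrable (D.indicator fun _ => C) P := (integrable_const C).indicator hD
  have h := outerExp_le_integral (P := P) (f := fun ω => min (m * Z ω) C)
    (U := fun ω => m * ε + D.indicator (fun _ => C) ω) (c := 0)
    (fun ω => le_min (mul_nonneg hm (hZ ω)) hC)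
    (measurable_const.add (measurable_const.indicator hD)) ((integrable_const _).add hi)
    (fun ω => by
      by_cases hω : ε ≤ Z ω
      · have : ω ∈ D := subset_toMeasurable _ _ hω
        rw [Set.indicator_of_mem this]
        exact (min_le_right _ _).trans (le_add_of_nonneg_left (by positivity))
      · refine (min_le_left _ _).trans ((mul_le_mul_of_nonneg_left (not_le.1 hω).le hm).trans ?_)
        exact le_add_of_nonneg_right (Set.indicator_nonneg (fun _ _ => hC) _))
  rw [integral_add (integrable_const _) hi, integral_indicator_const _ hD] at h
  simpa [D, measureReal_def, measure_toMeasurable, mul_comm] using h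

end OuterExp

/-! ### Lipschitz approximation from above -/

section SupConv

variable {E : Type*} [PseudoMetricSpace E]

/-- The sup-convolution of `f` with `-m * dist`. -/
def supConv (f : E →ᵇ ℝ) (m : ℝ) (x : E) : ℝ := ⨆ z, (f z - m * dist x z)

variable (f : E →ᵇ ℝ) {m : ℝ}

lemma bddAbove_supConv (hm : 0 ≤ m) (x : E) : BddAbove (Set.range fun z => f z - m * dist x z) := by
  refine ⟨‖f‖, ?_⟩
  rintro _ ⟨z, rfl⟩
  have := (abs_le.1 (f.norm_coe_le_norm z)).2
  have := mul_nonneg hm (dist_nonneg (x := x) (y := z))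
  simp only
  linarith

lemma le_supConv (hm : 0 ≤ m) (x : E) : f x ≤ supConv f m x := by
  refine le_trans ?_ (le_ciSup (bddAbove_supConv f hm x) x)
  simp

lemma supConv_le_norm (hm : 0 ≤ m) (x : E) : supConv f m x ≤ ‖f‖ := by
  have : Nonempty E := ⟨x⟩
  refine ciSup_le fun z => ?_
  have := (abs_le.1 (f.norm_coe_le_norm z)).2
  have := mul_nonneg hm (dist_nonneg (x := x) (y := z))
  linarith

lemma abs_supConv_le (hm : 0 ≤ m) (x : E) : |supConv f m x| ≤ ‖f‖ :=
  abs_le.2 ⟨(abs_le.1 (f.norm_coe_le_norm x)).1.trans (le_supConv f hm x), supConv_le_norm f hm x⟩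

lemma supConv_le_add (hm : 0 ≤ m) (x y : E) : supConv f m x ≤ supConv f m y + m * dist x y := by
  have : Nonempty E := ⟨x⟩
  refine ciSup_le fun z => ?_
  have h1 : f z - m * dist y z ≤ supConv f m y := le_ciSup (bddAbove_supConv f hm y) z
  have h2 := mul_le_mul_of_nonneg_left (dist_triangle_left y z x) hm
  linarith

lemma continuous_supConv (hm : 0 ≤ m) : Continuous (supConv f m) :=
  (LipschitzWith.of_le_add_mul (⟨m, hm⟩ : ℝ≥0) (supConv_le_add f hm)).continuous

/-- Near `x` continuity controls `f z`; at distance at least `η` the penalty `m * η` eventually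
exceeds `2 * ‖f‖`, the largest possible gain. -/
lemma tendsto_supConv (x : E) : Tendsto (fun m : ℕ => supConv f m x) atTop (𝓝 (f x)) := by
  have : Nonempty E := ⟨x⟩
  refine tendsto_order.2 ⟨fun a ha => Eventually.of_forall fun m =>
    ha.trans_le (le_supConv f m.cast_nonneg x), fun a ha => ?_⟩
  obtain ⟨b, hb, hba⟩ := exists_between ha
  obtain ⟨η, hη, hball⟩ := Metric.eventually_nhds_iff.1
    (f.continuous.continuousAt.eventually (gt_mem_nhds hb))
  filter_upwards [eventually_ge_atTop ⌈2 * ‖f‖ / η⌉₊] with m hm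
  refine lt_of_le_of_lt (ciSup_le fun z => ?_) hba
  have hmη : 2 * ‖f‖ ≤ m * η := (div_le_iff₀ hη).1 (Nat.ceil_le.1 hm)
  have hm0 : (0 : ℝ) ≤ m := m.cast_nonneg
  rcases lt_or_ge (dist z x) η with h | h
  · have := hball h
    have := mul_nonneg hm0 (dist_nonneg (x := x) (y := z))
    linarith
  · rw [dist_comm] at h
    have h1 := mul_le_mul_of_nonneg_left h hm0
    have h2 := (abs_le.1 (f.norm_coe_le_norm z)).2
    have h3 := (abs_le.1 (f.norm_coe_le_norm x)).1
    linarith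

end SupConv

/-! ### Weak convergence in the sense of Hoffmann-Jørgensen -/

section WeakConv

variable {Ω : ℕ → Type*} [∀ n, MeasurableSpace (Ω n)] {P : ∀ n, Measure (Ω n)}
  {Ω' : Type*} [MeasurableSpace Ω'] {Q : Measure Ω'}
  {E E' : Type*} [PseudoMetricSpace E] [PseudoMetricSpace E']
  {X X' : ∀ n, Ω n → E} {Y : Ω' → E}

lemma measurable_continuous_comp (hY : Measurable[_, borel E] Y) {f : E → ℝ}
    (hf : Continuous f) : Measurable fun ω => f (Y ω) := by
  let _ : MeasurableSpace E := borel E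
  have _ : BorelSpace E := ⟨rfl⟩
  exact hf.measurable.comp hY

lemma WeakConv.congr' (h : WeakConv P X Q Y) (hX : ∀ᶠ n in atTop, X n = X' n) :
    WeakConv P X' Q Y := by
  refine ⟨h.1, fun f => (h.2 f).congr' ?_⟩
  filter_upwards [hX] with n hn
  rw [hn]

/-- The continuous mapping theorem. -/
lemma WeakConv.comp_continuous (h : WeakConv P X Q Y) {φ : E → E'} (hφ : Continuous φ) :
    WeakConv P (fun n ω => φ (X n ω)) Q (fun ω => φ (Y ω)) := by
  refine ⟨?_, fun f => h.2 (f.compContinuous ⟨φ, hφ⟩)⟩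
  let _ : MeasurableSpace E := borel E
  have _ : BorelSpace E := ⟨rfl⟩
  let _ : MeasurableSpace E' := borel E'
  have _ : BorelSpace E' := ⟨rfl⟩
  exact hφ.measurable.comp h.1

variable [∀ n, IsProbabilityMeasure (P n)]

lemma WeakConv.eventually_measure_ge_le (h : WeakConv P X Q Y) {φ : E → ℝ} (hφ : Continuous φ)
    (hφ0 : ∀ x, 0 ≤ φ x) {r : ℝ} (hr : ∫ ω, min 1 (φ (Y ω)) ∂Q < r) :
    ∀ᶠ n in atTop, P n {ω | 1 ≤ φ (X n ω)} ≤ ENNReal.ofReal r := by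
  have hmin : ∀ x, 0 ≤ min 1 (φ x) := fun x => le_min zero_le_one (hφ0 x)
  have hlim := h.2 (BoundedContinuousFunction.ofNormedAddCommGroup (fun x => min 1 (φ x))
    (continuous_const.min hφ) 1 fun x => by
      rw [Real.norm_eq_abs, abs_of_nonneg (hmin x)]
      exact min_le_left _ _)
  filter_upwards [hlim.eventually (gt_mem_nhds hr)] with n hn
  refine le_trans (measure_mono fun ω hω => ?_)
    (measure_le_of_outerExp_lt (C := 1) (fun ω => hmin (X n ω)) (fun ω => min_le_left _ _) hn)
  exact le_min le_rfl (show 1 ≤ φ (X n ω) from hω)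

variable [IsProbabilityMeasure Q]

/-- If the functionals `φ m` tend to `0` along the limit `Y`, then some `φ m` is eventually smaller
than `1` along `X n` with large probability. -/
lemma WeakConv.exists_eventually_measure_ge_le (h : WeakConv P X Q Y) {φ : ℕ → E → ℝ}
    (hφ : ∀ m, Continuous (φ m)) (hφ0 : ∀ m x, 0 ≤ φ m x)
    (hlim : ∀ ω, Tendsto (fun m => φ m (Y ω)) atTop (𝓝 0)) {r : ℝ} (hr : 0 < r) :
    ∃ m, ∀ᶠ n in atTop, P n {ω | 1 ≤ φ m (X n ω)} ≤ ENNReal.ofReal r := by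
  have hint : Tendsto (fun m => ∫ ω, min 1 (φ m (Y ω)) ∂Q) atTop (𝓝 (∫ _, (0 : ℝ) ∂Q)) := by
    refine tendsto_integral_of_dominated_convergence (fun _ => 1) (fun m => ?_)
      (integrable_const _) (fun m => ?_) (Eventually.of_forall fun ω => ?_)
    · exact (measurable_continuous_comp h.1
        (continuous_const.min (hφ m))).aestronglyMeasurable
    · refine Eventually.of_forall fun ω => ?_
      rw [Real.norm_eq_abs, abs_of_nonneg (le_min zero_le_one (hφ0 _ _))]
      exact min_le_left _ _
    · have : Tendsto (fun m => min 1 (φ m (Y ω))) atTop (𝓝 (min 1 0)) :=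
        tendsto_const_nhds.min (hlim ω)
      simpa using this
  rw [integral_zero] at hint
  obtain ⟨m, hm⟩ := (hint.eventually (gt_mem_nhds hr)).exists
  exact ⟨m, h.eventually_measure_ge_le (hφ m) (hφ0 m) hm⟩

/-- The upper half of Slutsky's lemma. A Lipschitz majorant of `f` has nearly the same mean under
the limit, and replacing `X' n` by `X n` in it costs at most `min (m * dist) (2 * ‖f‖)`, whose outer
expectation is small. -/
lemma WeakConv.eventually_outerExp_lt_of_dist (h : WeakConv P X Q Y)
    (hd : ∀ ε : ℝ, 0 < ε → Tendsto (fun n => P n {ω | ε ≤ dist (X n ω) (X' n ω)}) atTop (𝓝 0))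
    (f : E →ᵇ ℝ) {r : ℝ} (hr : ∫ ω, f (Y ω) ∂Q < r) :
    ∀ᶠ n in atTop, outerExp (P n) (fun ω => f (X' n ω)) < r := by
  have hm0 : ∀ m : ℕ, (0 : ℝ) ≤ m := fun m => m.cast_nonneg
  have hint : Tendsto (fun m : ℕ => ∫ ω, supConv f m (Y ω) ∂Q) atTop (𝓝 (∫ ω, f (Y ω) ∂Q)) := by
    refine tendsto_integral_of_dominated_convergence (fun _ => ‖f‖) (fun m => ?_)
      (integrable_const _) (fun m => ?_) (Eventually.of_forall fun ω => tendsto_supConv f _)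
    · exact (measurable_continuous_comp h.1 (continuous_supConv f (hm0 m))).aestronglyMeasurable
    · exact Eventually.of_forall fun ω => abs_supConv_le f (hm0 m) _
  obtain ⟨r', hr', hrr⟩ := exists_between hr
  obtain ⟨m, hm⟩ := (hint.eventually (gt_mem_nhds hr')).exists
  have hlim := h.2 (BoundedContinuousFunction.ofNormedAddCommGroup (supConv f m)
    (continuous_supConv f (hm0 m)) ‖f‖ (abs_supConv_le f (hm0 m)))
  set ε := (r - r') / (2 * (m + 1)) with hε
  have hrr0 : 0 < r - r' := sub_pos.2 hrr
  have hε0 : 0 < ε := by positivity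
  have hsmall : Tendsto (fun n => m * ε + 2 * ‖f‖ * (P n).real {ω | ε ≤ dist (X n ω) (X' n ω)})
      atTop (𝓝 (m * ε + 2 * ‖f‖ * 0)) :=
    (((ENNReal.tendsto_toReal ENNReal.zero_ne_top).comp (hd ε hε0)).const_mul _).const_add _
  have hlt : m * ε + 2 * ‖f‖ * 0 < r - r' := by
    have : 2 * ((m : ℝ) + 1) * ε = r - r' := by rw [hε]; field_simp
    nlinarith [mul_nonneg (hm0 m) hε0.le]
  filter_upwards [hlim.eventually (gt_mem_nhds hm), hsmall.eventually (gt_mem_nhds hlt)] with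
    n h1 h2
  have hb : ∀ x, -‖f‖ ≤ f x := fun x => (abs_le.1 (f.norm_coe_le_norm x)).1
  have hsb : ∀ x, -‖f‖ ≤ supConv f m x := fun x => (abs_le.1 (abs_supConv_le f (hm0 m) x)).1
  have hsb' := supConv_le_norm f (hm0 m)
  have hmin0 : ∀ ω, 0 ≤ min (m * dist (X n ω) (X' n ω)) (2 * ‖f‖) := fun ω =>
    le_min (mul_nonneg (hm0 m) dist_nonneg) (by positivity)
  have h3 : outerExp (P n) (fun ω => f (X' n ω)) ≤ outerExp (P n) (fun ω => supConv f m (X n ω) +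
      min (m * dist (X n ω) (X' n ω)) (2 * ‖f‖)) := by
    refine outerExp_mono (C := ‖f‖ + 2 * ‖f‖) (fun ω => hb _)
      (fun ω => add_le_add (hsb' _) (min_le_right _ _)) fun ω => ?_
    refine (le_supConv f (hm0 m) _).trans ?_
    rw [← min_add_add_left]
    refine le_min ?_ (by linarith [hsb (X n ω), hsb' (X' n ω)])
    rw [dist_comm]
    exact supConv_le_add f (hm0 m) _ _
  have h4 := outerExp_add_le (P := P n) (fun ω => hsb (X n ω)) (fun ω => hsb' (X n ω)) hmin0
    (fun ω => min_le_right (m * dist (X n ω) (X' n ω)) (2 * ‖f‖))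
  have h5 := outerExp_min_le (P := P n) (Z := fun ω => dist (X n ω) (X' n ω))
    (fun ω => dist_nonneg) hε0.le (hm0 m) (by positivity : 0 ≤ 2 * ‖f‖)
  have h1' : outerExp (P n) (fun ω => supConv f m (X n ω)) < r' := h1
  linarith

/-- Slutsky's lemma: weak limits are not affected by perturbations that tend to zero in outer
probability. -/
lemma WeakConv.of_dist_tendsto_zero (h : WeakConv P X Q Y)
    (hd : ∀ ε : ℝ, 0 < ε → Tendsto (fun n => P n {ω | ε ≤ dist (X n ω) (X' n ω)}) atTop (𝓝 0)) :
    WeakConv P X' Q Y := by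
  refine ⟨h.1, fun f => tendsto_order.2 ⟨fun a ha => ?_, fun a ha =>
    h.eventually_outerExp_lt_of_dist hd f ha⟩⟩
  have hneg : ∫ ω, (-f) (Y ω) ∂Q < -a := by
    simp only [BoundedContinuousFunction.coe_neg, Pi.neg_apply, integral_neg]
    exact neg_lt_neg ha
  filter_upwards [h.eventually_outerExp_lt_of_dist hd (-f) hneg] with n hn
  have := neg_outerExp_neg_le (P := P n) (f := fun ω => f (X' n ω))
    (fun ω => (abs_le.1 (f.norm_coe_le_norm _)).1) (fun ω => (abs_le.1 (f.norm_coe_le_norm _)).2)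
  simp only [BoundedContinuousFunction.coe_neg, Pi.neg_apply] at hn
  linarith

end WeakConv

/-! ### The space `ℓ^∞(S)` -/

section Linf

variable {d : ℕ} {S T : Set (Fin d → ℝ)} {f g : (Fin d → ℝ) → ℝ}

lemma bddOnSet_iff : BddOnSet S f ↔ ∃ C, ∀ x ∈ S, |f x| ≤ C := by
  rw [BddOnSet, memℓp_infty_iff]
  constructor
  · rintro ⟨C, hC⟩
    exact ⟨C, fun x hx => hC ⟨⟨x, hx⟩, rfl⟩⟩
  · rintro ⟨C, hC⟩
    refine ⟨C, ?_⟩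
    rintro _ ⟨x, rfl⟩
    exact hC x x.2

lemma BddOnSet.mono (h : BddOnSet T f) (hST : S ⊆ T) : BddOnSet S f := by
  obtain ⟨C, hC⟩ := bddOnSet_iff.1 h
  exact bddOnSet_iff.2 ⟨C, fun x hx => hC x (hST hx)⟩

lemma toLinf_apply (h : BddOnSet S f) (x : S) : toLinf S f x = f x := by
  rw [toLinf, dif_pos h]

lemma dist_toLinf_le (hf : BddOnSet S f) (hg : BddOnSet S g) {C : ℝ} (hC : 0 ≤ C)
    (h : ∀ x ∈ S, |f x - g x| ≤ C) : dist (toLinf S f) (toLinf S g) ≤ C := by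
  rw [dist_eq_norm]
  refine lp.norm_le_of_forall_le hC fun x => ?_
  rw [lp.coeFn_sub, Pi.sub_apply, toLinf_apply hf, toLinf_apply hg]
  exact h x x.2

lemma abs_apply_le_norm (w : Linf S) (x : S) : |w x| ≤ ‖w‖ :=
  lp.norm_apply_le_norm ENNReal.top_ne_zero w x

/-- The restriction map `ℓ^∞(T) → ℓ^∞(S)` for `S ⊆ T`. -/
def restrictLinf (hST : S ⊆ T) (w : Linf T) : Linf S :=
  ⟨fun x => w ⟨x, hST x.2⟩, memℓp_infty_iff.2 ⟨‖w‖, by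
    rintro _ ⟨x, rfl⟩
    exact abs_apply_le_norm w _⟩⟩

lemma continuous_restrictLinf (hST : S ⊆ T) : Continuous (restrictLinf hST) := by
  refine (LipschitzWith.of_dist_le_mul (K := 1) fun v w => ?_).continuous
  rw [NNReal.coe_one, one_mul, dist_eq_norm, dist_eq_norm]
  exact lp.norm_le_of_forall_le (norm_nonneg _) fun x => abs_apply_le_norm (v - w) ⟨x, hST x.2⟩

lemma restrictLinf_toLinf (hST : S ⊆ T) (h : BddOnSet T f) :
    restrictLinf hST (toLinf T f) = toLinf S f := by
  refine lp.ext (funext fun x => ?_)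
  rw [toLinf_apply (h.mono hST)]
  exact toLinf_apply h _

/-- The modulus of continuity at `η` of a bounded function. -/
def osc (η : ℝ) (w : Linf S) : ℝ := ⨆ p : {p : S × S // dist p.1 p.2 ≤ η}, |w p.1.1 - w p.1.2|

lemma osc_nonneg (η : ℝ) (w : Linf S) : 0 ≤ osc η w := Real.iSup_nonneg fun _ => abs_nonneg _

lemma le_osc {η : ℝ} (w : Linf S) {x y : S} (h : dist x y ≤ η) : |w x - w y| ≤ osc η w := by
  refine le_ciSup (f := fun p : {p : S × S // dist p.1 p.2 ≤ η} => |w p.1.1 - w p.1.2|)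
    ⟨‖w‖ + ‖w‖, ?_⟩ ⟨(x, y), h⟩
  rintro _ ⟨p, rfl⟩
  exact (abs_sub _ _).trans (add_le_add (abs_apply_le_norm w _) (abs_apply_le_norm w _))

lemma osc_le {η C : ℝ} {w : Linf S} (hC : 0 ≤ C) (h : ∀ x y : S, dist x y ≤ η → |w x - w y| ≤ C) :
    osc η w ≤ C :=
  Real.iSup_le (fun p => h _ _ p.2) hC

lemma continuous_osc (η : ℝ) : Continuous (osc η : Linf S → ℝ) := by
  refine (LipschitzWith.of_le_add_mul (2 : ℝ≥0) fun v w => ?_).continuous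
  refine osc_le (add_nonneg (osc_nonneg _ _) (by positivity)) fun x y hxy => ?_
  have h1 := abs_le.1 (abs_apply_le_norm (v - w) x)
  have h2 := abs_le.1 (abs_apply_le_norm (v - w) y)
  have h3 := abs_le.1 (le_osc w hxy)
  rw [← dist_eq_norm, lp.coeFn_sub, Pi.sub_apply] at h1 h2
  rw [abs_le, NNReal.coe_ofNat]
  constructor <;> linarith [h1.1, h1.2, h2.1, h2.2, h3.1, h3.2]

/-- The modulus of continuity of a continuous function on a compact set vanishes at zero. -/
lemma tendsto_osc_toLinf (hS : IsCompact S) (hf : ContinuousOn f S) (hb : BddOnSet S f) :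
    Tendsto (fun m : ℕ => osc (1 / ((m : ℝ) + 1)) (toLinf S f)) atTop (𝓝 0) := by
  refine tendsto_order.2 ⟨fun a ha => Eventually.of_forall fun m => ha.trans_le (osc_nonneg _ _),
    fun a ha => ?_⟩
  obtain ⟨η, hη, hfη⟩ := Metric.uniformContinuousOn_iff.1
    (hS.uniformContinuousOn_of_continuous hf) (a / 2) (half_pos ha)
  filter_upwards [tendsto_one_div_add_atTop_nhds_zero_nat.eventually (gt_mem_nhds hη)] with m hm
  refine (osc_le (half_pos ha).le fun x y hxy => ?_).trans_lt (half_lt_self ha)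
  rw [toLinf_apply hb, toLinf_apply hb]
  exact (hfη x x.2 y y.2 (lt_of_le_of_lt hxy hm)).le

end Linf

/-! ### Restriction, perturbation, equicontinuity and tightness in `ℓ^∞(S)` -/

section WeakConvLinf

variable {d : ℕ} {S T : Set (Fin d → ℝ)} {Ω : ℕ → Type*} [∀ n, MeasurableSpace (Ω n)]
  {P : ∀ n, Measure (Ω n)} {X X' : ∀ n, Ω n → (Fin d → ℝ) → ℝ}
  {Ω' : Type*} [MeasurableSpace Ω'] {Q : Measure Ω'} {Y : Ω' → (Fin d → ℝ) → ℝ}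

lemma WeakConvLinf.mono (h : WeakConvLinf T P X Q Y) (hST : S ⊆ T) : WeakConvLinf S P X Q Y := by
  obtain ⟨hX, hY, hw⟩ := h
  refine ⟨hX.mono fun n hn ω => (hn ω).mono hST, fun ω => (hY ω).mono hST, ?_⟩
  have h1 := (hw.comp_continuous (continuous_restrictLinf hST)).congr'
    (X' := fun n ω => toLinf S (X n ω))
    (hX.mono fun n hn => funext fun ω => restrictLinf_toLinf hST (hn ω))
  simpa only [restrictLinf_toLinf hST (hY _)] using h1

variable [∀ n, IsProbabilityMeasure (P n)] [IsProbabilityMeasure Q]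

lemma WeakConvLinf.congr_of_isLittleOP (h : WeakConvLinf S P X Q Y)
    (hX' : ∀ᶠ n in atTop, ∀ ω, BddOnSet S (X' n ω))
    (hd : IsLittleOP P fun n ω => supNorm S fun x => X' n ω x - X n ω x) :
    WeakConvLinf S P X' Q Y := by
  obtain ⟨hX, hY, hw⟩ := h
  refine ⟨hX', hY, hw.of_dist_tendsto_zero fun ε hε => ?_⟩
  refine tendsto_of_tendsto_of_tendsto_of_le_of_le' tendsto_const_nhds
    (hd (ENNReal.ofReal ε) (ENNReal.ofReal_pos.2 hε)) (Eventually.of_forall fun n => zero_le) ?_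
  filter_upwards [hX, hX'] with n hn hn'
  refine measure_mono fun ω hω => ?_
  by_contra hlt
  have hlt : supNorm S (fun x => X' n ω x - X n ω x) < ENNReal.ofReal ε := not_le.1 hlt
  have hω : ε ≤ dist (toLinf S (X n ω)) (toLinf S (X' n ω)) := hω
  refine absurd hω (not_le.2 (lt_of_le_of_lt (dist_toLinf_le (hn ω) (hn' ω)
    ENNReal.toReal_nonneg fun x hx => ?_) ((ENNReal.lt_ofReal_iff_toReal_lt hlt.ne_top).1 hlt)))
  have h1 : ‖X' n ω x - X n ω x‖ₑ ≤ supNorm S fun x => X' n ω x - X n ω x :=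
    le_iSup₂_of_le x hx le_rfl
  have h2 := ENNReal.toReal_mono hlt.ne_top h1
  rwa [toReal_enorm, norm_sub_rev] at h2

/-- Weak convergence to a process with continuous trajectories on a compact set entails asymptotic
equicontinuity in probability. -/
lemma WeakConvLinf.exists_osc (h : WeakConvLinf S P X Q Y) (hS : IsCompact S)
    (hcont : ∀ ω, ContinuousOn (Y ω) S) {ε r : ℝ} (hε : 0 < ε) (hr : 0 < r) :
    ∃ η > 0, ∀ᶠ n in atTop,
      P n {ω | ε ≤ osc η (toLinf S (X n ω))} ≤ ENNReal.ofReal r := by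
  obtain ⟨hX, hY, hw⟩ := h
  obtain ⟨m, hm⟩ := hw.exists_eventually_measure_ge_le
    (φ := fun m w => osc (1 / ((m : ℝ) + 1)) w / ε)
    (fun m => (continuous_osc _).div_const _) (fun m w => div_nonneg (osc_nonneg _ _) hε.le)
    (fun ω => by simpa using (tendsto_osc_toLinf hS (hcont ω) (hY ω)).div_const ε) hr
  refine ⟨1 / ((m : ℝ) + 1), by positivity, hm.mono fun n hn => ?_⟩
  simpa only [one_le_div₀ hε] using hn

/-- Weakly convergent sequences are bounded in probability. -/
lemma WeakConvLinf.exists_norm (h : WeakConvLinf S P X Q Y) {r : ℝ} (hr : 0 < r) :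
    ∃ M > 0, ∀ᶠ n in atTop, P n {ω | M ≤ ‖toLinf S (X n ω)‖} ≤ ENNReal.ofReal r := by
  obtain ⟨hX, hY, hw⟩ := h
  obtain ⟨m, hm⟩ := hw.exists_eventually_measure_ge_le
    (φ := fun m w => ‖w‖ * (1 / ((m : ℝ) + 1)))
    (fun m => continuous_norm.mul_const _) (fun m w => by positivity)
    (fun ω => by
      simpa using (tendsto_one_div_add_atTop_nhds_zero_nat (𝕜 := ℝ)).const_mul ‖toLinf S (Y ω)‖) hr
  refine ⟨m + 1, by positivity, hm.mono fun n hn => ?_⟩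
  have : ∀ a : ℝ, 1 ≤ a * (1 / ((m : ℝ) + 1)) ↔ (m : ℝ) + 1 ≤ a := fun a => by
    rw [mul_one_div, one_le_div₀ (by positivity)]
  simpa only [this] using hn

end WeakConvLinf

/-! ### The smoothing error -/

section Smoothing

variable {d n : ℕ} {k : ℝ} {l : (Fin d → ℝ) → ℝ}

/-- The grid does not depend on `x`, so the maximum of `|g|` over it bounds the smoothed function
everywhere. -/
lemma bddOnSet_betaSmooth (hk : 0 < k) (g : (Fin d → ℝ) → ℝ) (S : Set (Fin d → ℝ)) :
    BddOnSet S (betaSmooth n k g) := by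
  obtain ⟨C, hC⟩ := ((finite_grid (d := d) (n := n) (k := k)).image fun y => |g y|).bddAbove
  refine bddOnSet_iff.2 ⟨C, fun x _ => ?_⟩
  rw [betaSmooth_eq_integral hk]
  refine (abs_integral_le_integral_abs).trans ?_
  calc ∫ y, |g y| ∂(betaSmoother n k x) ≤ ∫ _, C ∂(betaSmoother n k x) := by
        refine integral_mono_ae (integrable_betaSmoother _) (integrable_const _) ?_
        filter_upwards [ae_mem_grid] with y hy using hC ⟨y, hy, rfl⟩
    _ = C := by simp

lemma IsStdf.abs_le (hl : IsStdf d l) {M : ℝ} {y : Fin d → ℝ} (hy : y ∈ cube d M) :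
    |l y| ≤ |l 0| + d * M := by
  have h1 := hl.abs_sub_le hy.1 (le_refl (0 : Fin d → ℝ))
  have h2 : ∑ j, |y j - (0 : Fin d → ℝ) j| ≤ d * M := by
    refine (Finset.sum_le_card_nsmul _ _ M fun j _ => ?_).trans_eq (by simp)
    rw [Pi.zero_apply, sub_zero, abs_of_nonneg (hy.1 j)]
    exact hy.2 j
  have := abs_sub_abs_le_abs_sub (l y) (l 0)
  linarith

/-- The average over the beta smoother of the increments of a function `w` in terms of the modulus
of continuity and the supremum of `w` on a neighbourhood of `[0, 1]^d`, and the growth of `w`. -/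
lemma abs_integral_increment_le (hk : 0 < k) (hkn : k ≤ n) {δ η s O M R : ℝ} (hδ : 0 ≤ δ)
    (hη : 0 < η) (hs : 0 ≤ s) (hs1 : s ≤ 1) (hO : 0 ≤ O) (hR : 0 ≤ R) {w : (Fin d → ℝ) → ℝ}
    (hosc : ∀ x ∈ cube d (1 + δ), ∀ y ∈ cube d (1 + δ), dist x y ≤ η → |w x - w y| ≤ O)
    (hM : ∀ x ∈ cube d (1 + δ), |w x| ≤ M) (hRw : ∀ y ∈ cube d ((n : ℝ) / k), |w y| ≤ R)
    {x : Fin d → ℝ} (hx : x ∈ cube d 1) :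
    |∫ y, (w y - w x) ∂(betaSmoother n k x)| ≤
      O + 2 * M / η ^ 2 * (d * (1 / k)) + (R + M) * (d * Real.exp (-(s * (δ - s)) * k)) := by
  set μ := betaSmoother n k x with hμ
  have hint : ∀ f : (Fin d → ℝ) → ℝ, Integrable f μ := integrable_betaSmoother
  have hxδ : x ∈ cube d (1 + δ) := ⟨hx.1, fun j => (hx.2 j).trans (by simpa using hδ)⟩
  have hM0 : 0 ≤ M := (abs_nonneg _).trans (hM x hxδ)
  have hx1 : ∀ j, x j ≤ 1 := fun j => hx.2 j
  have hmeas : MeasurableSet (cube d (1 + δ)) := measurableSet_Icc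
  have hpt : ∀ y ∈ cube d ((n : ℝ) / k), |w y - w x| ≤
      O + 2 * M / η ^ 2 * ∑ j, (y j - x j) ^ 2 +
        (cube d (1 + δ))ᶜ.indicator (fun _ => R + M) y := by
    intro y hy
    have hsq := dist_sq_le_sum_sq x y
    have hsum0 : 0 ≤ ∑ j, (y j - x j) ^ 2 := Finset.sum_nonneg fun j _ => sq_nonneg _
    by_cases hyc : y ∈ cube d (1 + δ)
    · rw [Set.indicator_of_notMem (by simpa using hyc), add_zero]
      rcases le_or_gt (dist x y) η with h | h
      · rw [abs_sub_comm]
        exact (hosc x hxδ y hyc h).trans (le_add_of_nonneg_right (by positivity))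
      · have h1 : |w y - w x| ≤ 2 * M := by
          have := abs_sub (w y) (w x)
          linarith [hM x hxδ, hM y hyc]
        -- Chebyshev's inequality in pointwise form.
        have h2 : 1 ≤ (∑ j, (y j - x j) ^ 2) / η ^ 2 := by
          rw [one_le_div₀ (by positivity)]
          exact (pow_le_pow_left₀ hη.le h.le 2).trans hsq
        have h3 : 2 * M / η ^ 2 * ∑ j, (y j - x j) ^ 2 =
            2 * M * ((∑ j, (y j - x j) ^ 2) / η ^ 2) := by ring
        rw [h3]
        nlinarith
    · rw [Set.indicator_of_mem hyc]
      have := abs_sub (w y) (w x)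
      have h4 : 0 ≤ 2 * M / η ^ 2 * ∑ j, (y j - x j) ^ 2 := by positivity
      linarith [hM x hxδ, hRw y hy]
  calc |∫ y, (w y - w x) ∂μ| ≤ ∫ y, |w y - w x| ∂μ := abs_integral_le_integral_abs
    _ ≤ ∫ y, (O + 2 * M / η ^ 2 * ∑ j, (y j - x j) ^ 2 +
        (cube d (1 + δ))ᶜ.indicator (fun _ => R + M) y) ∂μ := by
        refine integral_mono_ae (hint _) (hint _) ?_
        filter_upwards [ae_mem_cube hk] with y hy using hpt y hy
    _ = O + 2 * M / η ^ 2 * ∑ j, ∫ y, (y j - x j) ^ 2 ∂μ +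
        (R + M) * μ.real (cube d (1 + δ))ᶜ := by
        rw [integral_add (hint _) (hint _), integral_add (hint _) (hint _), integral_const_mul,
          integral_finsetSum _ fun j _ => hint _, integral_indicator_const _ hmeas.compl]
        simp [mul_comm]
    _ ≤ _ := by
        refine add_le_add (add_le_add le_rfl (mul_le_mul_of_nonneg_left ?_ (by positivity)))
          (mul_le_mul_of_nonneg_left (measureReal_betaSmoother_compl_cube_le hk hkn hx hs hs1)
            (by positivity))
        refine (Finset.sum_le_card_nsmul _ _ (1 / k) fun j _ => ?_).trans_eq (by simp)
        exact (integral_betaSmoother_sq_sub_le hk hkn hx j).trans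
          (div_le_div_of_nonneg_right (hx1 j) hk.le)

lemma smoothing_error_eq (hk : 0 < k) (g : (Fin d → ℝ) → ℝ) (x : Fin d → ℝ) :
    √k * (betaSmooth n k g x - l x) - √k * (g x - l x) =
      ∫ y, (√k * (g y - l y) - √k * (g x - l x)) ∂(betaSmoother n k x) +
        √k * ∫ y, (l y - l x) ∂(betaSmoother n k x) := by
  have hint : ∀ f : (Fin d → ℝ) → ℝ, Integrable f (betaSmoother n k x) := integrable_betaSmoother
  rw [betaSmooth_eq_integral hk, integral_sub (hint fun y => √k * (g y - l y)) (hint _),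
    integral_const_mul, integral_sub (hint g) (hint l), integral_sub (hint l) (hint _)]
  simp only [integral_const, probReal_univ, one_smul]
  ring

end Smoothing

/-! ### The asymptotic equivalence -/

section Asymptotics

variable {k : ℕ → ℝ}

lemma tendsto_atTop_of_log_isLittleO (hlog : (fun n : ℕ => Real.log n) =o[atTop] k)
    (hk : ∀ n : ℕ, 1 ≤ n → 0 < k n) : Tendsto k atTop atTop := by
  refine tendsto_atTop_mono' _ ?_ (Real.tendsto_log_atTop.comp tendsto_natCast_atTop_atTop)
  filter_upwards [hlog.bound one_pos, eventually_ge_atTop 1] with n hn h1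
  rw [one_mul, Real.norm_eq_abs, Real.norm_eq_abs, abs_of_pos (hk n h1)] at hn
  exact (le_abs_self _).trans hn

lemma tendsto_mul_exp_neg (hlog : (fun n : ℕ => Real.log n) =o[atTop] k)
    (hk : ∀ n : ℕ, 1 ≤ n → 0 < k n) {c : ℝ} (hc : 0 < c) :
    Tendsto (fun n : ℕ => (n : ℝ) * Real.exp (-c * k n)) atTop (𝓝 0) := by
  refine squeeze_zero' (Eventually.of_forall fun n => by positivity) ?_
    tendsto_one_div_atTop_nhds_zero_nat
  filter_upwards [hlog.bound (half_pos hc), eventually_ge_atTop 1] with n hn h1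
  rw [Real.norm_eq_abs, Real.norm_eq_abs, abs_of_pos (hk n h1)] at hn
  -- Half of the rate `c` gives `exp (-c * k n) ≤ n⁻²`, leaving a spare factor `1 / n`.
  have h2 : Real.log n ≤ c / 2 * k n := (le_abs_self _).trans hn
  have hn0 : (0 : ℝ) < n := by exact_mod_cast h1
  have h3 : Real.exp (-c * k n) ≤ Real.exp (-Real.log n + -Real.log n) :=
    Real.exp_le_exp.2 (by linarith)
  rw [Real.exp_add, Real.exp_neg, Real.exp_log hn0] at h3
  calc (n : ℝ) * Real.exp (-c * k n) ≤ n * ((n : ℝ)⁻¹ * (n : ℝ)⁻¹) :=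
        mul_le_mul_of_nonneg_left h3 hn0.le
    _ = 1 / n := by field_simp

lemma sqrt_mul_add_le {n : ℕ} {k A B M : ℝ} (hk1 : 1 ≤ k) (hkn : k ≤ n)
    (hA : 0 ≤ A) (hB : 0 ≤ B) (hM : 0 ≤ M) :
    √k * (A * (n / k) + B) + M ≤ (A + B + M) * n := by
  have hk0 : 0 < k := by linarith
  have hsk : √k ≤ k := Real.sqrt_le_iff.2 ⟨hk0.le, by nlinarith⟩
  have hn0 : (0 : ℝ) ≤ n := by linarith
  calc √k * (A * (n / k) + B) + M ≤ k * (A * (n / k) + B) + M :=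
        add_le_add (mul_le_mul_of_nonneg_right hsk (by positivity)) le_rfl
    _ = A * n + B * k + M * 1 := by field_simp
    _ ≤ A * n + B * n + M * n := by
        gcongr
        linarith
    _ = _ := by ring

lemma abs_le_of_supNorm_le {d : ℕ} {S : Set (Fin d → ℝ)} {f : (Fin d → ℝ) → ℝ} {C : ℝ}
    (hC : 0 ≤ C) (h : supNorm S f ≤ ENNReal.ofReal C) {x : Fin d → ℝ} (hx : x ∈ S) :
    |f x| ≤ C := by
  have h1 : ‖f x‖ₑ ≤ ENNReal.ofReal C :=
    le_trans (le_iSup₂_of_le (f := fun x (_ : x ∈ S) => ‖f x‖ₑ) x hx le_rfl) h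
  have h2 := ENNReal.toReal_mono ENNReal.ofReal_ne_top h1
  rwa [toReal_enorm, ENNReal.toReal_ofReal hC] at h2

lemma supNorm_le_ofReal {d : ℕ} {S : Set (Fin d → ℝ)} {f : (Fin d → ℝ) → ℝ} {C : ℝ}
    (h : ∀ x ∈ S, |f x| ≤ C) : supNorm S f ≤ ENNReal.ofReal C := by
  refine iSup₂_le fun x hx => ?_
  rw [← ofReal_norm]
  exact ENNReal.ofReal_le_ofReal (h x hx)

variable {d : ℕ} {Ω : ℕ → Type*} [∀ n, MeasurableSpace (Ω n)] {P : ∀ n, Measure (Ω n)}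
  [∀ n, IsProbabilityMeasure (P n)] {l : (Fin d → ℝ) → ℝ}
  {lhat : ∀ n, Ω n → (Fin d → ℝ) → ℝ} {δ : ℝ} {Ω' : Type*} [MeasurableSpace Ω']
  {Q : Measure Ω'} [IsProbabilityMeasure Q] {B : Ω' → (Fin d → ℝ) → ℝ}

/-- Smoothing does not affect the estimator at the scale `1 / √k`. -/
lemma isLittleOP_smoothing_error (hl : IsStdf d l) (hk : ∀ n : ℕ, 1 ≤ n → 0 < k n ∧ k n ≤ n)
    (hlog : (fun n : ℕ => Real.log n) =o[atTop] k) (hsmooth : HasContPartials d l)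
    (hgrowth : IsBigOP P (fun n ω => supNorm (cube d ((n : ℝ) / k n)) (lhat n ω))
      (fun n => (n : ℝ) / k n)) (hδ : 0 < δ)
    (hBcont : ∀ ω, ContinuousOn (B ω) (cube d (1 + δ)))
    (hweak : WeakConvLinf (cube d (1 + δ)) P (fun n ω x => √(k n) * (lhat n ω x - l x)) Q B) :
    IsLittleOP P (fun n ω => supNorm (cube d 1) (fun x =>
      √(k n) * (betaSmooth n (k n) (lhat n ω) x - l x) - √(k n) * (lhat n ω x - l x))) := by
  intro ε' hε'
  obtain ⟨e, he0, heε⟩ := ENNReal.lt_iff_exists_nnreal_btwn.1 hε'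
  set ε := (e : ℝ) with hε_def
  have hε : 0 < ε := NNReal.coe_pos.2 (ENNReal.coe_pos.1 he0)
  have hεε' : ENNReal.ofReal ε < ε' := by rwa [hε_def, ENNReal.ofReal_coe_nnreal]
  refine ENNReal.tendsto_nhds_zero.2 fun q hq => ?_
  obtain ⟨r', hr'0, hr'q⟩ := ENNReal.lt_iff_exists_nnreal_btwn.1 hq
  -- One third for each of three bad events. Likewise `ε / 5` matches five error terms: modulus,
  -- Chebyshev, tail, and the two parts of the bias bound.
  set r := (r' : ℝ) / 3 with hr_def
  have hr'pos : (0 : ℝ) < r' := NNReal.coe_pos.2 (ENNReal.coe_pos.1 hr'0)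
  have hr : 0 < r := by positivity
  obtain ⟨η, hη, hE1⟩ := hweak.exists_osc isCompact_Icc hBcont (ε := ε / 5) (by positivity) hr
  obtain ⟨M, hM, hE2⟩ := hweak.exists_norm hr
  obtain ⟨A, hE3⟩ := hgrowth (ENNReal.ofReal r) (ENNReal.ofReal_pos.2 hr)
  obtain ⟨C, hC, hbias⟩ := hl.exists_bias_bound hsmooth (ε := ε / 5) (by positivity)
  -- The Chernoff parameter: `s ≤ 1` is required by the bound, and `s ≤ δ / 2` makes the rate `s *
  -- (δ - s)` positive.
  set s := min 1 (δ / 2)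
  have hs0 : 0 < s := lt_min one_pos (half_pos hδ)
  have hs1 : s ≤ 1 := min_le_left _ _
  have hsδ : s ≤ δ / 2 := min_le_right _ _
  have hc : 0 < s * (δ - s) := mul_pos hs0 (by linarith)
  have hk0 : ∀ n : ℕ, 1 ≤ n → 0 < k n := fun n hn => (hk n hn).1
  have hktop := tendsto_atTop_of_log_isLittleO hlog hk0
  have hlim1 : Tendsto (fun n => C / √(k n)) atTop (𝓝 0) :=
    (Real.tendsto_sqrt_atTop.comp hktop).const_div_atTop C
  have hlim2 : Tendsto (fun n => 2 * M / η ^ 2 * (d * (1 / k n))) atTop (𝓝 0) := by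
    simpa using ((hktop.const_div_atTop 1).const_mul (d : ℝ)).const_mul (2 * M / η ^ 2)
  have hlim3 : Tendsto (fun n : ℕ => ((A + d + |l 0| + M) * d) *
      ((n : ℝ) * Real.exp (-(s * (δ - s)) * k n))) atTop (𝓝 0) := by
    simpa using (tendsto_mul_exp_neg hlog hk0 hc).const_mul ((A + d + |l 0| + M) * d)
  have hε5 : 0 < ε / 5 := by positivity
  filter_upwards [hE1, hE2, hE3, hweak.1, eventually_ge_atTop 1, hktop.eventually_ge_atTop 1,
    hlim1.eventually (gt_mem_nhds hε5), hlim2.eventually (gt_mem_nhds hε5),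
    hlim3.eventually (gt_mem_nhds hε5)] with n h1 h2 h3 hbdd hn1 hk1 hl1 hl2 hl3
  obtain ⟨hkpos, hkn⟩ := hk n hn1
  set W : Ω n → (Fin d → ℝ) → ℝ := fun ω x => √(k n) * (lhat n ω x - l x) with hW
  -- Off the three bad events the estimate is deterministic. None of these sets need be measurable;
  -- monotonicity and subadditivity of outer measure suffice.
  have hsub : {ω | ε' ≤ supNorm (cube d 1) (fun x =>
      √(k n) * (betaSmooth n (k n) (lhat n ω) x - l x) - √(k n) * (lhat n ω x - l x))} ⊆
      {ω | ε / 5 ≤ osc η (toLinf (cube d (1 + δ)) (W ω))} ∪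
        ({ω | M ≤ ‖toLinf (cube d (1 + δ)) (W ω)‖} ∪
        {ω | A * ENNReal.ofReal ((n : ℝ) / k n) <
          supNorm (cube d ((n : ℝ) / k n)) (lhat n ω)}) := by
    intro ω hω
    by_contra hcon
    simp only [Set.mem_union, Set.mem_ofPred_eq, not_or, not_le, not_lt] at hcon
    obtain ⟨hc1, hc2, hc3⟩ := hcon
    refine absurd (lt_of_lt_of_le hεε' hω) (not_lt.2 (supNorm_le_ofReal fun x hx => ?_))
    have hnk : 0 ≤ (n : ℝ) / k n := by positivity
    have hc3' : supNorm (cube d ((n : ℝ) / k n)) (lhat n ω) ≤ ENNReal.ofReal (A * (n / k n)) := by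
      rwa [ENNReal.ofReal_mul A.coe_nonneg, ENNReal.ofReal_coe_nnreal]
    have hosc : ∀ x ∈ cube d (1 + δ), ∀ y ∈ cube d (1 + δ), dist x y ≤ η →
        |W ω x - W ω y| ≤ ε / 5 := by
      intro x hx y hy hxy
      have := le_osc (toLinf (cube d (1 + δ)) (W ω)) (x := ⟨x, hx⟩) (y := ⟨y, hy⟩) hxy
      rw [toLinf_apply (hbdd ω), toLinf_apply (hbdd ω)] at this
      exact this.trans hc1.le
    have hnorm : ∀ x ∈ cube d (1 + δ), |W ω x| ≤ M := by
      intro x hx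
      have := abs_apply_le_norm (toLinf (cube d (1 + δ)) (W ω)) ⟨x, hx⟩
      rw [toLinf_apply (hbdd ω)] at this
      exact this.trans hc2.le
    have hgr : ∀ y ∈ cube d ((n : ℝ) / k n),
        |W ω y| ≤ √(k n) * ((A + d) * (n / k n) + |l 0|) := by
      intro y hy
      rw [hW, abs_mul, abs_of_nonneg (Real.sqrt_nonneg _)]
      refine mul_le_mul_of_nonneg_left ?_ (Real.sqrt_nonneg _)
      have ha := abs_le_of_supNorm_le (by positivity) hc3' hy
      have hb := hl.abs_le hy
      have := abs_sub (lhat n ω y) (l y)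
      linarith
    rw [smoothing_error_eq hkpos]
    refine (abs_add_le _ _).trans ?_
    have hb := hbias n (k n) hkpos hkn x hx
    have hi := abs_integral_increment_le hkpos hkn hδ.le hη hs0.le hs1 hε5.le (by positivity)
      hosc hnorm hgr hx
    rw [abs_mul, abs_of_nonneg (Real.sqrt_nonneg _)]
    have ht : (√(k n) * ((A + d) * (n / k n) + |l 0|) + M) *
        (d * Real.exp (-(s * (δ - s)) * k n)) ≤ ε / 5 := by
      refine le_trans (mul_le_mul_of_nonneg_right (sqrt_mul_add_le hk1 hkn (by positivity)
        (abs_nonneg _) hM.le) (by positivity)) (le_of_eq_of_le ?_ hl3.le)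
      ring
    linarith
  calc _ ≤ _ := measure_mono hsub
    _ ≤ ENNReal.ofReal r + (ENNReal.ofReal r + ENNReal.ofReal r) :=
      (measure_union_le _ _).trans (add_le_add h1 ((measure_union_le _ _).trans (add_le_add h2 h3)))
    _ = r' := by
      rw [← ENNReal.ofReal_add hr.le hr.le, ← ENNReal.ofReal_add hr.le (by positivity),
        ← ENNReal.ofReal_coe_nnreal]
      congr 1
      rw [hr_def]
      ring
    _ ≤ q := hr'q.le

end Asymptotics

end BetaStdf

end

theorem mainTheorem1 (d : ℕ)
    {Ω : ℕ → Type*} [∀ n, MeasurableSpace (Ω n)]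
    (P : ∀ n, Measure (Ω n)) [∀ n, IsProbabilityMeasure (P n)]
    -- the stdf
    (l : (Fin d → ℝ) → ℝ) (hl : BetaStdf.IsStdf d l)
    -- the tuning parameter
    (k : ℕ → ℝ) (hk : ∀ n : ℕ, 1 ≤ n → 0 < k n ∧ k n ≤ n)
    (hlog : (fun n : ℕ => Real.log n) =o[atTop] k)
    (hkn : k =o[atTop] (fun n : ℕ => (n : ℝ)))
    -- the pilot estimators; only their values on `[0, n / k_n]^d` matter
    (lhat : ∀ n, Ω n → (Fin d → ℝ) → ℝ)
    -- smoothness of the stdf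
    (hsmooth : BetaStdf.HasContPartials d l)
    -- growth condition on the pilot estimators
    (hgrowth : BetaStdf.IsBigOP P
      (fun n ω => BetaStdf.supNorm (BetaStdf.cube d ((n : ℝ) / k n)) (lhat n ω))
      (fun n => (n : ℝ) / k n))
    -- weak convergence of the pilot estimators on `[0, 1 + δ]^d`
    (δ : ℝ) (hδ : 0 < δ)
    {Ω' : Type*} [MeasurableSpace Ω'] (Q : Measure Ω') [IsProbabilityMeasure Q]
    (B : Ω' → (Fin d → ℝ) → ℝ)
    (hBcont : ∀ ω, ContinuousOn (B ω) (BetaStdf.cube d (1 + δ)))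
    (hweak : BetaStdf.WeakConvLinf (BetaStdf.cube d (1 + δ)) P
      (fun n ω x => √(k n) * (lhat n ω x - l x)) Q B) :
    BetaStdf.IsLittleOP P
      (fun n ω => BetaStdf.supNorm (BetaStdf.cube d 1) (fun x =>
        √(k n) * (BetaStdf.betaSmooth n (k n) (lhat n ω) x - l x)
          - √(k n) * (lhat n ω x - l x))) ∧
    BetaStdf.WeakConvLinf (BetaStdf.cube d 1) P
      (fun n ω x => √(k n) * (lhat n ω x - l x)) Q B ∧
    BetaStdf.WeakConvLinf (BetaStdf.cube d 1) P
      (fun n ω x => √(k n) * (BetaStdf.betaSmooth n (k n) (lhat n ω) x - l x)) Q B := by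
  have hkpos : ∀ n : ℕ, 1 ≤ n → 0 < k n := fun n hn => (hk n hn).1
  have herr := BetaStdf.isLittleOP_smoothing_error hl hk hlog hsmooth hgrowth hδ hBcont hweak
  have hw := hweak.mono (S := BetaStdf.cube d 1)
    (Set.Icc_subset_Icc le_rfl fun _ => (le_add_iff_nonneg_right 1).2 hδ.le)
  refine ⟨herr, hw, hw.congr_of_isLittleOP ?_ herr⟩
  filter_upwards [eventually_ge_atTop 1] with n hn ω
  obtain ⟨C, hC⟩ := BetaStdf.bddOnSet_iff.1
    (BetaStdf.bddOnSet_betaSmooth (n := n) (hkpos n hn) (lhat n ω) (BetaStdf.cube d 1))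
  refine BetaStdf.bddOnSet_iff.2 ⟨√(k n) * (C + (|l 0| + d * 1)), fun x hx => ?_⟩
  rw [abs_mul, abs_of_nonneg (Real.sqrt_nonneg _)]
  refine mul_le_mul_of_nonneg_left ?_ (Real.sqrt_nonneg _)
  exact (abs_sub _ _).trans (add_le_add (hC x hx) (hl.abs_le hx))
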